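/- **Definitions.** All graphs are finite and simple. A *class* of graphs is a set of labeled graphs closed under isomorphism; besides classes of graphs we consider classes of bipartite graphs $(X,Y,E)$ with a fixed bipartition, closed under isomorphisms that respect the two sides. The adjacency matrix $\mathrm{Adj}_G\in\{\pm1\}^{V\times V}$ of a graph $G=(V,E)$ has $\mathrm{Adj}_G(x,y)=1$ iff $xy\in E$; for a bipartite graph $G=(X,Y,E)$, $\mathrm{Adj}_G\in\{\pm1\}^{X\times Y}$ denotes the bipartite adjacency matrix, with $\mathrm{Adj}_G(x,y)=1$ iff $xy\in E$. * For a matrix $M\in\{\pm1\}^{X\times Y}$, $\mathsf R(M)$ is its two-way public-coin randomized communication complexity with success probability $2/3$: the least $c$ such that some probability distribution on deterministic two-party protocols, each communicating at most $c$ bits, outputs $M(x,y)$ with probability at least $2/3$ on every input $(x,y)$. For a class $\mathcal G$ (of graphs or of bipartite graphs), $\mathsf R(\mathcal G)$ is the function $N\mapsto\max\{\mathsf R(\mathrm{Adj}_G): G\in\mathcal G \text{ has } N \text{ vertices}\}$. * A graph $G$ is a *unit disk graph* (UDG) if there is $\phi:V(G)\to\mathbb R^2$ such that distinct $x,y$ are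 adjacent iff $\|\phi(x)-\phi(y)\|_2<2$. A bipartite graph is a UDG if its underlying graph on $X\sqcup Y$ is. * Let $\operatorname{sign}(t)=1$ if $t\ge0$ and $-1$ otherwise. The *sign-rank* of a bipartite graph $G=(X,Y,E)$ is the least rank of a matrix $R\in\mathbb R^{X\times Y}$ with $\operatorname{sign}(R_{x,y})=\mathrm{Adj}_G(x,y)$ for all $x,y$; the sign-rank of a graph $G=(V,E)$ is the least rank of a matrix $R\in\mathbb R^{V\times V}$ with $\operatorname{sign}(R_{x,y})=\mathrm{Adj}_G(x,y)$ for all $x\ne y$. A class has sign-rank at most $d$ if all its members do. * The *chain-index* $\mathrm{ch}(G)$ is the largest $k$ such that there are disjoint sets of vertices $\{a_1,\dots,a_k\}$ and $\{b_1,\dots,b_k\}$, each of size $k$, where for all $i<j$, $a_i,b_j$ are adjacent but $b_i,a_j$ are not (for a bipartite graph, in its underlying graph). A class $\mathcal G$ is *stable* if there is a constant $k$ with $\mathrm{ch}(G)\le k$ for all $G\in\mathcal G$. * A class $\mathcal G$ admits an *implicit representation* if there is a decoder $D:\{0,1\}^*\times\{0,1\}^*\to\{0,1\}$ such that, for every $N$-vertex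 $G\in\mathcal G$, each vertex $v$ of $G$ can be assigned an encoding $\mathrm{enc}(v)$ of $O(\log N)$ bits such that, for all vertices $u,v$ of $G$, $D(\mathrm{enc}(u),\mathrm{enc}(v))=1$ iff $u,v$ are adjacent in $G$ (in its underlying graph, if $G$ is bipartite); $D$ depends on $\mathcal G$ but not on $G$. **Theorem 1.2.** Let $\mathcal G$ be a class of graphs, or a class of bipartite graphs with fixed bipartitions, that either is a subclass of the unit disk graphs or has sign-rank at most $3$. Then $\mathsf R(\mathcal G)=O(1)$ if and only if $\mathcal G$ is stable. Consequently, if $\mathcal G$ is stable, then $\mathcal G$ admits an implicit representation. -/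

import Mathlib

open Filter Asymptotics
open scoped ENNReal

noncomputable section

namespace GraphComm

universe u v

/-! ### Public-coin randomized communication complexity -/

/-- Deterministic two-party protocol trees. At a node owned by Alice (Bob) she (he) sends one bit,
which depends on her (his) input only; each leaf carries the output in `{1, -1}`. -/
inductive Protocol (X : Type u) (Y : Type v) : Type (max u v)
  | output (b : ℤˣ) : Protocol X Y
  | alice (f : X → Bool) (p₀ p₁ : Protocol X Y) : Protocol X Y
  | bob (g : Y → Bool) (p₀ p₁ : Protocol X Y) : Protocol X Y

/-- The output of the protocol on the input pair `(x, y)`. -/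
def Protocol.run {X : Type u} {Y : Type v} : Protocol X Y → X → Y → ℤˣ
  | .output b, _, _ => b
  | .alice f p₀ p₁, x, y => bif f x then p₁.run x y else p₀.run x y
  | .bob g p₀ p₁, x, y => bif g y then p₁.run x y else p₀.run x y

/-- The cost of a deterministic protocol: the depth of its tree, that is, the largest number of
bits that are communicated. -/
def Protocol.cost {X : Type u} {Y : Type v} : Protocol X Y → ℕ
  | .output _ => 0
  | .alice _ p₀ p₁ => max p₀.cost p₁.cost + 1
  | .bob _ p₀ p₁ => max p₀.cost p₁.cost + 1

/-- A public-coin randomized protocol is a probability distribution `μ` on deterministic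
protocols: the shared random string selects the deterministic protocol that both players follow.
It computes the sign matrix `M` (with success probability `2/3`) at cost at most `c` if every
protocol that can be selected communicates at most `c` bits and, on each input pair, the output is
correct with probability at least `2/3`. -/
def ComputesWithCost {X : Type u} {Y : Type v} (M : Matrix X Y ℤˣ) (μ : PMF (Protocol X Y))
    (c : ℕ) : Prop :=
  (∀ p ∈ μ.support, p.cost ≤ c) ∧
    ∀ x y, (2 / 3 : ℝ≥0∞) ≤ μ.toOuterMeasure {p | p.run x y = M x y}

/-- The public-coin randomized communication complexity `R(M)`. -/
def randCC {X : Type u} {Y : Type v} (M : Matrix X Y ℤˣ) : ℕ :=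
  sInf {c | ∃ μ : PMF (Protocol X Y), ComputesWithCost M μ c}

/-! ### Graphs and bipartite graphs -/

/-- A bipartite graph `(X, Y, E)` with a fixed bipartition. -/
@[ext]
structure BipartiteGraph (X : Type u) (Y : Type v) where
  /-- `Adj x y` says that `xy` is an edge. -/
  Adj : X → Y → Prop

/-- The underlying graph of a bipartite graph, on the vertex set `X ⊔ Y`. -/
def BipartiteGraph.toSimpleGraph {X : Type u} {Y : Type v} (B : BipartiteGraph X Y) :
    SimpleGraph (X ⊕ Y) where
  Adj
    | .inl x, .inr y => B.Adj x y
    | .inr y, .inl x => B.Adj x y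
    | _, _ => False
  symm := ⟨by rintro (x | y) (x' | y') h <;> exact h⟩
  loopless := ⟨by rintro (x | y) h <;> exact h⟩

open Classical in
/-- The adjacency matrix of a graph, with entries in `{1, -1}`. -/
def adjSign {V : Type u} (G : SimpleGraph V) : Matrix V V ℤˣ :=
  fun x y => if G.Adj x y then 1 else -1

open Classical in
/-- The bipartite adjacency matrix, with entries in `{1, -1}`. -/
def BipartiteGraph.adjSign {X : Type u} {Y : Type v} (B : BipartiteGraph X Y) : Matrix X Y ℤˣ :=
  fun x y => if B.Adj x y then 1 else -1

/-! ### Sign-rank, unit disk graphs, chain-index -/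

/-- The sign of a real number in `{1, -1}`, where `0` has sign `1`. -/
def sgn (t : ℝ) : ℤˣ := if 0 ≤ t then 1 else -1

/-- The sign-rank of a bipartite graph: the least rank of a real matrix whose sign matrix is the
bipartite adjacency matrix. -/
def BipartiteGraph.signRank {X : Type u} {Y : Type v} [Fintype X] [Fintype Y]
    (B : BipartiteGraph X Y) : ℕ :=
  sInf {d | ∃ R : Matrix X Y ℝ, R.rank = d ∧ ∀ x y, sgn (R x y) = B.adjSign x y}

/-- The sign-rank of a graph: the least rank of a real matrix whose signs agree with the adjacency
matrix off the diagonal. -/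
def signRank {V : Type u} [Fintype V] (G : SimpleGraph V) : ℕ :=
  sInf {d | ∃ R : Matrix V V ℝ, R.rank = d ∧ ∀ x y, x ≠ y → sgn (R x y) = adjSign G x y}

/-- Unit disk graphs: distinct vertices are adjacent if and only if the open unit disks around the
points assigned to them intersect. -/
def IsUnitDisk {V : Type u} (G : SimpleGraph V) : Prop :=
  ∃ φ : V → EuclideanSpace ℝ (Fin 2), ∀ x y, x ≠ y → (G.Adj x y ↔ ‖φ x - φ y‖ < 2)

/-- `G` contains disjoint sets `{a₁, …, aₖ}` and `{b₁, …, bₖ}` of vertices such that, for all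
`i < j`, `aᵢ` and `bⱼ` are adjacent but `bᵢ` and `aⱼ` are not. -/
def HasChain {V : Type u} (G : SimpleGraph V) (k : ℕ) : Prop :=
  ∃ a b : Fin k → V, Function.Injective a ∧ Function.Injective b ∧ (∀ i j, a i ≠ b j) ∧
    ∀ i j, i < j → G.Adj (a i) (b j) ∧ ¬ G.Adj (b i) (a j)

/-- The chain-index of a (finite) graph. -/
def chainIndex {V : Type u} (G : SimpleGraph V) : ℕ := sSup {k | HasChain G k}

/-! ### Classes of graphs -/

/-- A class of finite labeled graphs (on the vertex sets `Fin N`), closed under isomorphism. -/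
structure GraphClass where
  /-- The members on `N` vertices. -/
  members : ∀ N : ℕ, Set (SimpleGraph (Fin N))
  /-- Closure under isomorphism. -/
  iso_closed : ∀ (N : ℕ) (G H : SimpleGraph (Fin N)),
    Nonempty (G ≃g H) → G ∈ members N → H ∈ members N

/-- A class of finite labeled bipartite graphs with fixed bipartitions, closed under isomorphisms
(that respect the two sides). -/
structure BipartiteGraphClass where
  /-- The members with sides of sizes `m` and `n`. -/
  members : ∀ m n : ℕ, Set (BipartiteGraph (Fin m) (Fin n))
  /-- Closure under isomorphism. -/
  iso_closed : ∀ (m n : ℕ) (B C : BipartiteGraph (Fin m) (Fin n)) (σ : Fin m ≃ Fin m)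
    (τ : Fin n ≃ Fin n), (∀ x y, B.Adj x y ↔ C.Adj (σ x) (τ y)) → B ∈ members m n → C ∈ members m n

namespace GraphClass

/-- `𝒢` is a subclass of the unit disk graphs. -/
def IsUnitDisk (𝒢 : GraphClass) : Prop :=
  ∀ N, ∀ G ∈ 𝒢.members N, GraphComm.IsUnitDisk G

/-- All members of `𝒢` have sign-rank at most `d`. -/
def SignRankAtMost (𝒢 : GraphClass) (d : ℕ) : Prop :=
  ∀ N, ∀ G ∈ 𝒢.members N, signRank G ≤ d

/-- `𝒢` is stable: the chain-index is bounded on `𝒢`. -/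
def Stable (𝒢 : GraphClass) : Prop :=
  ∃ k : ℕ, ∀ N, ∀ G ∈ 𝒢.members N, chainIndex G ≤ k

/-- The function `R(𝒢)`: the maximum of `R(Adj_G)` over the `N`-vertex members `G`. -/
def commCost (𝒢 : GraphClass) (N : ℕ) : ℕ∞ :=
  ⨆ G ∈ 𝒢.members N, (randCC (adjSign G) : ℕ∞)

/-- `R(𝒢) = O(1)`. -/
def ConstantCost (𝒢 : GraphClass) : Prop := ∃ c : ℕ, ∀ N, 𝒢.commCost N ≤ c

/-- `𝒢` admits an implicit representation: for one decoder `D`, the vertices of each `N`-vertex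
member have labels of `O(log N)` bits from which `D` determines adjacency. -/
def AdmitsImplicitRepresentation (𝒢 : GraphClass) : Prop :=
  ∃ (D : List Bool → List Bool → Bool) (ℓ : ℕ → ℕ),
    (fun N => (ℓ N : ℝ)) =O[atTop] (fun N : ℕ => Real.log N) ∧
    ∀ N, ∀ G ∈ 𝒢.members N, ∃ enc : Fin N → List Bool,
      (∀ w, (enc w).length ≤ ℓ N) ∧ ∀ w z, D (enc w) (enc z) = true ↔ G.Adj w z

end GraphClass

namespace BipartiteGraphClass

/-- `𝒢` is a class of unit disk graphs. -/
def IsUnitDisk (𝒢 : BipartiteGraphClass) : Prop :=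
  ∀ m n, ∀ B ∈ 𝒢.members m n, GraphComm.IsUnitDisk B.toSimpleGraph

/-- All members of `𝒢` have sign-rank at most `d`. -/
def SignRankAtMost (𝒢 : BipartiteGraphClass) (d : ℕ) : Prop :=
  ∀ m n, ∀ B ∈ 𝒢.members m n, B.signRank ≤ d

/-- `𝒢` is stable: the chain-index is bounded on `𝒢`. -/
def Stable (𝒢 : BipartiteGraphClass) : Prop :=
  ∃ k : ℕ, ∀ m n, ∀ B ∈ 𝒢.members m n, chainIndex B.toSimpleGraph ≤ k

/-- The function `R(𝒢)`: the maximum of `R(Adj_B)` over the `N`-vertex members `B`, where `Adj_B`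
is the bipartite adjacency matrix. -/
def commCost (𝒢 : BipartiteGraphClass) (N : ℕ) : ℕ∞ :=
  ⨆ (m : ℕ) (n : ℕ) (_ : m + n = N), ⨆ B ∈ 𝒢.members m n, (randCC B.adjSign : ℕ∞)

/-- `R(𝒢) = O(1)`. -/
def ConstantCost (𝒢 : BipartiteGraphClass) : Prop := ∃ c : ℕ, ∀ N, 𝒢.commCost N ≤ c

/-- `𝒢` admits an implicit representation: for one decoder `D`, the vertices (on both sides) of
each `N`-vertex member have labels of `O(log N)` bits from which `D` determines adjacency. -/
def AdmitsImplicitRepresentation (𝒢 : BipartiteGraphClass) : Prop :=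
  ∃ (D : List Bool → List Bool → Bool) (ℓ : ℕ → ℕ),
    (fun N => (ℓ N : ℝ)) =O[atTop] (fun N : ℕ => Real.log N) ∧
    ∀ m n, ∀ B ∈ 𝒢.members m n, ∃ enc : Fin m ⊕ Fin n → List Bool,
      (∀ w, (enc w).length ≤ ℓ (m + n)) ∧
        ∀ w z, D (enc w) (enc z) = true ↔ B.toSimpleGraph.Adj w z

end BipartiteGraphClass

end GraphComm

end

/-!
# Stable unit disk graphs and stable graphs of sign-rank at most three

*Stability is sufficient.* The geometry is used only through one property of a relation `P` between
points `x`, ordered by a real coordinate, and regions `y`: there are no regions `y`, `y'` and points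
`x₁ ≤ x₂ ≤ x₃` such that `x₁` and `x₃` belong to `y` only and `x₂` to `y'` only (`ABAFree`). Points
above lines have it, since the difference of two lines is affine (`abaFree_of_sign_eq`); unit disk
graphs have it between two cells of a fine square grid, since the upper half-circles of equal radius
behave like pseudolines (`abaFree_disk`).

An `ABAFree` relation without long half-graphs is decided by boundedly many equality tests
(`eqDecides_of_abaFree`). A strictly increasing sequence of neighborhoods `N(y)` gives a half-graph,
so the regions fall into boundedly many antichains. The members of an antichain are linearly ordered
from left to right, and a Ramsey argument shows that along this order each point alternates boundedly
often between being inside and outside (`exists_alternation_bound`). Next, by Hodges' argument, a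
relation without long half-graphs has bounded Littlestone dimension (`SplitTree.chain`). Cut the order
greedily into intervals of smaller dimension. If some point belonged to all the regions of an interval
together with its successor, and to none of the regions of another one, the total dimension would be
too large. Hence every point has a default answer, which is correct for all but boundedly many
intervals. The players find out by equality tests whether they are in one of the exceptional
intervals, and then proceed recursively (`eqDecides_of_alternation`).

Equality tests have constant-cost public-coin protocols by random hashing
(`exists_computesWithCost_of_eqDecides`), and they yield labels of `O(log N)` bits if each player
writes down the values to be compared (`exists_labels`).

*Stability is necessary.* A dyadic weighting of the pairs `i ≠ j` has small discrepancy on rectangles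
(`abs_gtSum_le`), while it correlates perfectly with the order, so that protocols of bounded cost
cannot recognize arbitrarily long half-graphs (`exists_chain_bound`).
-/

namespace GraphComm

/-! ### Chains and splitting trees of a relation -/

/-- The relation `P` contains, between the sets `A` and `B`, a half-graph of length `k` (with
arbitrary diagonal): `P (a i) (b j)` holds for `i < j` and fails for `i > j`. -/
def Chain {X Y : Type} (P : X → Y → Prop) (A : Set X) (B : Set Y) (k : ℕ) : Prop :=
  ∃ (a : Fin k → X) (b : Fin k → Y), (∀ i, a i ∈ A) ∧ (∀ i, b i ∈ B) ∧
    ∀ i j, i < j → P (a i) (b j) ∧ ¬ P (a j) (b i)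

theorem Chain.mono {X Y : Type} {P : X → Y → Prop} {A A' : Set X} {B B' : Set Y} {k : ℕ}
    (h : Chain P A B k) (hA : A ⊆ A') (hB : B ⊆ B') : Chain P A' B' k := by
  obtain ⟨a, b, ha, hb, hab⟩ := h
  exact ⟨a, b, fun i => hA (ha i), fun i => hB (hb i), hab⟩

theorem Chain.comp {X Y : Type} {P : X → Y → Prop} {A : Set X} {B : Set Y} {k l : ℕ}
    (h : Chain P A B k) (e : Fin l → Fin k) (he : StrictMono e) : Chain P A B l := by
  obtain ⟨a, b, ha, hb, hab⟩ := h
  exact ⟨a ∘ e, b ∘ e, fun _ => ha _, fun _ => hb _, fun _ _ hij => hab _ _ (he hij)⟩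

theorem Chain.of_le {X Y : Type} {P : X → Y → Prop} {A : Set X} {B : Set Y} {k l : ℕ}
    (h : Chain P A B k) (hl : l ≤ k) : Chain P A B l :=
  h.comp (Fin.castLE hl) (Fin.strictMono_castLE hl)

theorem Chain.of_reverse {X Y : Type} {P : X → Y → Prop} {A : Set X} {B : Set Y} {k : ℕ}
    (a : Fin k → X) (b : Fin k → Y) (ha : ∀ i, a i ∈ A) (hb : ∀ i, b i ∈ B)
    (hab : ∀ i j, i < j → P (a j) (b i) ∧ ¬ P (a i) (b j)) : Chain P A B k :=
  ⟨a ∘ Fin.rev, b ∘ Fin.rev, fun _ => ha _, fun _ => hb _,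
    fun _ _ hij => hab _ _ (Fin.rev_lt_rev.2 hij)⟩

theorem Chain.cons {X Y : Type} {P : X → Y → Prop} {A A' : Set X} {B B' : Set Y} {k : ℕ}
    (h : Chain P A' B' k) (hA : A' ⊆ A) (hB : B' ⊆ B) {x : X} {y : Y} (hx : x ∈ A) (hy : y ∈ B)
    (hxB : ∀ y' ∈ B', P x y') (hyA : ∀ x' ∈ A', ¬ P x' y) : Chain P A B (k + 1) := by
  obtain ⟨a, b, ha, hb, hab⟩ := h
  refine ⟨Fin.cons x a, Fin.cons y b, ?_, ?_, ?_⟩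
  · exact Fin.cases hx fun i => hA (ha i)
  · exact Fin.cases hy fun i => hB (hb i)
  · intro i j
    refine Fin.cases ?_ (fun i => ?_) i <;> refine Fin.cases ?_ (fun j => ?_) j
    · exact fun h => absurd h (lt_irrefl _)
    · exact fun _ => ⟨hxB _ (hb j), hyA _ (ha j)⟩
    · exact fun h => absurd h (Fin.not_lt_zero _)
    · exact fun h => hab i j (Fin.succ_lt_succ_iff.1 h)

theorem Chain.snoc {X Y : Type} {P : X → Y → Prop} {A A' : Set X} {B B' : Set Y} {k : ℕ}
    (h : Chain P A' B' k) (hA : A' ⊆ A) (hB : B' ⊆ B) {x : X} {y : Y} (hx : x ∈ A) (hy : y ∈ B)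
    (hxB : ∀ y' ∈ B', ¬ P x y') (hyA : ∀ x' ∈ A', P x' y) : Chain P A B (k + 1) := by
  obtain ⟨a, b, ha, hb, hab⟩ := h
  refine ⟨Fin.snoc a x, Fin.snoc b y, ?_, ?_, ?_⟩
  · refine Fin.lastCases ?_ fun i => ?_
    · simpa using hx
    · simpa using hA (ha i)
  · refine Fin.lastCases ?_ fun i => ?_
    · simpa using hy
    · simpa using hB (hb i)
  · intro i j
    refine Fin.lastCases ?_ (fun i => ?_) i <;> refine Fin.lastCases ?_ (fun j => ?_) j
    · exact fun h => absurd h (lt_irrefl _)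
    · exact fun h => absurd h (not_lt.2 (Fin.le_last _))
    · intro _
      simpa using ⟨hyA _ (ha i), hxB _ (hb i)⟩
    · intro h
      simpa using hab i j (Fin.castSucc_lt_castSucc_iff.1 h)

/-- A full binary tree of height `n` whose inner nodes are labeled by elements of `A` and whose
leaves are elements of `B`: a leaf below the left (right) child of a node labeled `x` is (is not)
`P`-related to `x`. The largest possible height is the Littlestone dimension. -/
def SplitTree {X Y : Type} (P : X → Y → Prop) (A : Set X) : ℕ → Set Y → Prop
  | 0, B => B.Nonempty
  | n + 1, B => ∃ x ∈ A, SplitTree P A n {y ∈ B | P x y} ∧ SplitTree P A n {y ∈ B | ¬ P x y}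

theorem SplitTree.mono {X Y : Type} {P : X → Y → Prop} {A A' : Set X} (hA : A ⊆ A') {n : ℕ} :
    ∀ {B B' : Set Y}, B ⊆ B' → SplitTree P A n B → SplitTree P A' n B' := by
  induction n with
  | zero => exact fun hB h => Set.Nonempty.mono hB h
  | succ n ih =>
    rintro B B' hB ⟨x, hx, h1, h2⟩
    exact ⟨x, hA hx, ih (fun y hy => ⟨hB hy.1, hy.2⟩) h1, ih (fun y hy => ⟨hB hy.1, hy.2⟩) h2⟩

theorem SplitTree.nonempty {X Y : Type} {P : X → Y → Prop} {A : Set X} {n : ℕ} :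
    ∀ {B : Set Y}, SplitTree P A n B → B.Nonempty := by
  induction n with
  | zero => exact fun h => h
  | succ n ih =>
    rintro B ⟨x, hx, h1, h2⟩
    exact (ih h1).mono fun y hy => hy.1

/-- Ramsey property of splitting trees: if the inner nodes are colored with two colors, then one
of the colors contains a tall subtree. -/
theorem SplitTree.ramsey {X Y : Type} {P : X → Y → Prop} {A A₁ A₂ : Set X} (hA : A ⊆ A₁ ∪ A₂) :
    ∀ (n p q : ℕ) (B : Set Y), p + q = n → SplitTree P A n B →
      SplitTree P A₁ p B ∨ SplitTree P A₂ q B := by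
  intro n
  induction n with
  | zero =>
    intro p q B hpq h
    obtain rfl : p = 0 := by omega
    exact Or.inl h
  | succ n ih =>
    intro p q B hpq h
    rcases Nat.eq_zero_or_pos p with rfl | hp
    · exact Or.inl h.nonempty
    rcases Nat.eq_zero_or_pos q with rfl | hq
    · exact Or.inr h.nonempty
    obtain ⟨p, rfl⟩ : ∃ p', p = p' + 1 := ⟨p - 1, by omega⟩
    obtain ⟨q, rfl⟩ : ∃ q', q = q' + 1 := ⟨q - 1, by omega⟩
    obtain ⟨x, hx, h1, h2⟩ := h
    have sub1 : {y ∈ B | P x y} ⊆ B := fun y hy => hy.1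
    have sub2 : {y ∈ B | ¬ P x y} ⊆ B := fun y hy => hy.1
    rcases hA hx with hx1 | hx2
    · rcases ih p (q + 1) _ (by omega) h1 with h1 | h1
      · rcases ih p (q + 1) _ (by omega) h2 with h2 | h2
        · exact Or.inl ⟨x, hx1, h1, h2⟩
        · exact Or.inr (h2.mono subset_rfl sub2)
      · exact Or.inr (h1.mono subset_rfl sub1)
    · rcases ih (p + 1) q _ (by omega) h1 with h1 | h1
      · exact Or.inl (h1.mono subset_rfl sub1)
      · rcases ih (p + 1) q _ (by omega) h2 with h2 | h2
        · exact Or.inl (h2.mono subset_rfl sub2)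
        · exact Or.inr ⟨x, hx2, h1, h2⟩

/-- A height of splitting trees that forces a chain of length `k`. -/
def splitBound : ℕ → ℕ
  | 0 => 0
  | k + 1 => (splitBound k + 1) + (splitBound k + 1)

/-- Hodges' argument that a relation of large Littlestone dimension contains a long half-graph. Fix
a leaf `y` and color the nodes `x` by the truth value of `P x y`; a tall monochromatic subtree has
a root `x`, and the pair `(x, y)` can be appended to a chain that is found in one of the two halves
of this subtree. -/
theorem SplitTree.chain {X Y : Type} {P : X → Y → Prop} (k : ℕ) :
    ∀ {A : Set X} {B : Set Y}, SplitTree P A (splitBound k) B → Chain P A B k := by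
  induction k with
  | zero =>
    intro A B h
    exact ⟨Fin.elim0, Fin.elim0, fun i => i.elim0, fun i => i.elim0, fun i => i.elim0⟩
  | succ k ih =>
    intro A B h
    obtain ⟨y, hy⟩ := h.nonempty
    have hA : A ⊆ {x ∈ A | P x y} ∪ {x ∈ A | ¬ P x y} := fun x hx => by
      by_cases hxy : P x y
      · exact Or.inl ⟨hx, hxy⟩
      · exact Or.inr ⟨hx, hxy⟩
    rcases SplitTree.ramsey hA _ _ _ B rfl h with h | h
    · obtain ⟨x, hx, -, h2⟩ := h
      exact (ih h2).snoc (fun x hx => hx.1) (fun y hy => hy.1) hx.1 hy (fun y' hy' => hy'.2)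
        fun x' hx' => hx'.2
    · obtain ⟨x, hx, h1, -⟩ := h
      exact (ih h1).cons (fun x hx => hx.1) (fun y hy => hy.1) hx.1 hy (fun y' hy' => hy'.2)
        fun x' hx' => hx'.2

/-! ### Relations decided by boundedly many equality tests -/

/-- On `A × B`, the relation `P` is determined by the outcomes of the equality tests
`f x i = g y i`, `i : ι`, where the way it depends on the outcomes may depend on `x`. This is the
nonadaptive form of a deterministic protocol with an oracle for Equality. -/
def EqDecides {X Y : Type} (ι : Type) (A : Set X) (B : Set Y) (P : X → Y → Prop) : Prop :=
  ∃ (f : X → ι → ℕ) (g : Y → ι → ℕ) (F : X → Set ι → Prop),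
    ∀ x ∈ A, ∀ y ∈ B, P x y ↔ F x {i | f x i = g y i}

theorem EqDecides.congr {X Y ι : Type} {A : Set X} {B : Set Y} {P Q : X → Y → Prop}
    (h : EqDecides ι A B P) (hPQ : ∀ x ∈ A, ∀ y ∈ B, Q x y ↔ P x y) : EqDecides ι A B Q := by
  obtain ⟨f, g, F, h⟩ := h
  exact ⟨f, g, F, fun x hx y hy => (hPQ x hx y hy).trans (h x hx y hy)⟩

theorem EqDecides.mono {X Y ι : Type} {A A' : Set X} {B B' : Set Y} {P : X → Y → Prop}
    (h : EqDecides ι A' B' P) (hA : A ⊆ A') (hB : B ⊆ B') : EqDecides ι A B P := by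
  obtain ⟨f, g, F, h⟩ := h
  exact ⟨f, g, F, fun x hx y hy => h x (hA hx) y (hB hy)⟩

theorem EqDecides.comap {X Y X' Y' ι : Type} {P : X → Y → Prop} (h : EqDecides ι .univ .univ P)
    (φ : X' → X) (ψ : Y' → Y) : EqDecides ι .univ .univ fun x y => P (φ x) (ψ y) := by
  obtain ⟨f, g, F, h⟩ := h
  exact ⟨f ∘ φ, g ∘ ψ, F ∘ φ, fun x _ y _ => h _ trivial _ trivial⟩

/-- More equality tests than needed do no harm. -/
theorem EqDecides.extend {X Y ι κ : Type} {A : Set X} {B : Set Y} {P : X → Y → Prop}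
    (h : EqDecides ι A B P) (e : ι → κ) (he : Function.Injective e) : EqDecides κ A B P := by
  obtain ⟨f, g, F, h⟩ := h
  refine ⟨fun x => Function.extend e (f x) 0, fun y => Function.extend e (g y) 0,
    fun x U => F x (e ⁻¹' U), fun x hx y hy => ?_⟩
  rw [h x hx y hy]
  simp [Set.preimage, he.extend_apply]

/-- Relations can be composed along an equality test: if the test `f x i = g y` succeeds for some
`i`, then both players know the common value and can follow a protocol that depends on it;
otherwise the answer is determined by `x`. -/
theorem EqDecides.gate {X Y κ ι : Type} {A : Set X} {B : Set Y} {P : X → Y → Prop}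
    (f : X → κ → ℕ) (g : Y → ℕ) (D : X → Prop)
    (h0 : ∀ x ∈ A, ∀ y ∈ B, (∀ i, f x i ≠ g y) → (P x y ↔ D x))
    (h : ∀ c i, EqDecides ι {x ∈ A | f x i = c} {y ∈ B | g y = c} P) :
    EqDecides (κ ⊕ κ × ι) A B P := by
  choose f' g' F' hF using h
  refine ⟨fun x => Sum.elim (f x) fun j => f' (f x j.1) j.1 x j.2,
    fun y => Sum.elim (fun _ => g y) fun j => g' (g y) j.1 y j.2,
    fun x U => (∃ i, Sum.inl i ∈ U ∧ F' (f x i) i x {j | Sum.inr (i, j) ∈ U}) ∨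
      (∀ i, Sum.inl i ∉ U) ∧ D x, fun x hx y hy => ?_⟩
  simp only [Set.mem_ofPred_eq, Sum.elim_inl, Sum.elim_inr]
  have key : ∀ i, f x i = g y →
      (P x y ↔ F' (f x i) i x {j | f' (f x i) i x j = g' (g y) i y j}) := by
    intro i hi
    have := hF (f x i) i x ⟨hx, rfl⟩ y ⟨hy, hi.symm⟩
    rwa [hi] at this ⊢
  by_cases hm : ∃ i, f x i = g y
  · constructor
    · obtain ⟨i, hi⟩ := hm
      exact fun hP => Or.inl ⟨i, hi, (key i hi).1 hP⟩
    · rintro (⟨i, hi, h⟩ | ⟨h, -⟩)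
      · exact (key i hi).2 h
      · exact absurd hm (by simpa using h)
  · push Not at hm
    rw [h0 x hx y hy hm]
    constructor
    · exact fun h => Or.inr ⟨hm, h⟩
    · rintro (⟨i, hi, h⟩ | ⟨-, h⟩)
      · exact absurd hi (hm i)
      · exact h

theorem EqDecides.cover_left {X Y T ι : Type} {A : Set X} {B : Set Y} {P : X → Y → Prop}
    (σ : X → T) (h : ∀ t, EqDecides ι {x ∈ A | σ x = t} B P) : EqDecides (T × ι) A B P := by
  choose f g F hF using h
  refine ⟨fun x j => f j.1 x j.2, fun y j => g j.1 y j.2,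
    fun x U => F (σ x) x {i | (σ x, i) ∈ U}, fun x hx y hy => ?_⟩
  exact hF (σ x) x ⟨hx, rfl⟩ y hy

/-- The roles of the two players can be exchanged: the way in which the answer depends on the
outcomes of the tests is communicated by finitely many further tests. -/
theorem EqDecides.swap {X Y ι : Type} {A : Set X} {B : Set Y} {P : X → Y → Prop}
    (h : EqDecides ι A B P) : EqDecides (ι ⊕ Set ι) B A fun y x => P x y := by
  classical
  obtain ⟨f, g, F, hF⟩ := h
  refine ⟨fun y => Sum.elim (g y) fun _ => 1,
    fun x => Sum.elim (f x) fun U => if F x U then 1 else 0,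
    fun _ U => Sum.inr {i | Sum.inl i ∈ U} ∈ U, fun y hy x hx => ?_⟩
  refine (hF x hx y hy).trans ?_
  simp [eq_comm]

theorem EqDecides.of_finite {X Y : Type} [Finite Y] (P : X → Y → Prop) :
    ∃ n, EqDecides (Fin n) .univ .univ P := by
  classical
  obtain ⟨n, ⟨e⟩⟩ := Finite.exists_equiv_fin Y
  refine ⟨n, fun _ _ => 1, fun y i => if e y = i then 1 else 0,
    fun x U => ∃ i ∈ U, P x (e.symm i), fun x _ y _ => ?_⟩
  simp

/-! ### Families with boundedly many alternations -/

theorem exists_strictMono_or_subset_range (S : Set ℕ) (M : ℕ) :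
    (∃ s : Fin M → ℕ, StrictMono s ∧ ∀ i, s i ∈ S) ∨ ∃ f : Fin M → ℕ, S ⊆ Set.range f := by
  by_cases h : ∃ T : Finset ℕ, ↑T ⊆ S ∧ T.card = M
  · obtain ⟨T, hT, hc⟩ := h
    exact Or.inl ⟨T.orderEmbOfFin hc, (T.orderEmbOfFin hc).strictMono,
      fun i => hT (T.orderEmbOfFin_mem hc i)⟩
  · right
    have hfin : S.Finite := by
      by_contra hinf
      obtain ⟨T, hT⟩ := Set.Infinite.exists_subset_card_eq hinf M
      exact h ⟨T, hT⟩
    have hlt : hfin.toFinset.card < M := by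
      by_contra hle
      obtain ⟨T, hT, hc⟩ := Finset.exists_subset_card_eq (not_lt.1 hle)
      exact h ⟨T, fun x hx => hfin.mem_toFinset.1 (hT hx), hc⟩
    refine ⟨fun i => if hi : i.1 < hfin.toFinset.card then
      hfin.toFinset.orderEmbOfFin rfl ⟨i, hi⟩ else 0, fun x hx => ?_⟩
    have hx' : x ∈ Set.range (hfin.toFinset.orderEmbOfFin rfl) := by
      rw [Finset.range_orderEmbOfFin]
      simpa using hx
    obtain ⟨j, rfl⟩ := hx'
    exact ⟨⟨j, j.2.trans hlt⟩, by simp⟩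

/-- The starting point of the block that contains `r`, when `ℕ` is cut greedily into blocks that
are as long as possible subject to `Good (start) (last element)`. -/
noncomputable def blockStart (Good : ℕ → ℕ → Prop) : ℕ → ℕ
  | 0 => 0
  | r + 1 => open Classical in
    if Good (blockStart Good r) (r + 1) then blockStart Good r else r + 1

theorem blockStart_le (Good : ℕ → ℕ → Prop) (r : ℕ) : blockStart Good r ≤ r := by
  induction r with
  | zero => exact le_rfl
  | succ r ih =>
    rw [blockStart]
    split_ifs <;> omega

theorem blockStart_mono (Good : ℕ → ℕ → Prop) : Monotone (blockStart Good) := by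
  refine monotone_nat_of_le_succ fun r => ?_
  have := blockStart_le Good r
  conv_rhs => rw [blockStart]
  split_ifs <;> omega

theorem blockStart_good {Good : ℕ → ℕ → Prop} (h : ∀ r, Good r r) (r : ℕ) :
    Good (blockStart Good r) r := by
  cases r with
  | zero => exact h 0
  | succ r =>
    rw [blockStart]
    split_ifs with hg
    · exact hg
    · exact h _

/-- If the block of `r` is not the last one, then it cannot be extended to the first element `e` of
the next block. -/
theorem blockStart_next {Good : ℕ → ℕ → Prop} {r r' : ℕ}
    (h : blockStart Good r < blockStart Good r') :
    ∃ e, r < e ∧ e ≤ blockStart Good r' ∧ ¬ Good (blockStart Good r) e := by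
  classical
  have hr : r < r' := by
    by_contra hle
    exact absurd (blockStart_mono Good (not_lt.1 hle)) (not_le.2 h)
  have hex : ∃ d, blockStart Good (r + d) ≠ blockStart Good r :=
    ⟨r' - r, by rw [Nat.add_sub_cancel' hr.le]; exact h.ne'⟩
  set d := Nat.find hex with hd
  have hd0 : d ≠ 0 := fun h0 => by
    have := Nat.find_spec hex
    rw [← hd, h0] at this
    exact this rfl
  obtain ⟨d', hd'⟩ := Nat.exists_eq_succ_of_ne_zero hd0
  have hprev : blockStart Good (r + d') = blockStart Good r := by
    by_contra hne
    have := Nat.find_min' hex hne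
    omega
  have hspec : blockStart Good (r + d' + 1) ≠ blockStart Good r := by
    have := Nat.find_spec hex
    rwa [← hd, hd'] at this
  have hr' : r + d' + 1 ≤ r' := by
    by_contra hlt
    have h1 := blockStart_mono Good (show r' ≤ r + d' by omega)
    omega
  have hunfold : ¬ Good (blockStart Good r) (r + d' + 1) ∧
      blockStart Good (r + d' + 1) = r + d' + 1 := by
    rw [blockStart, hprev] at hspec
    rw [blockStart, hprev]
    split_ifs at hspec ⊢ with hg
    · exact absurd rfl hspec
    · exact ⟨hg, rfl⟩
  refine ⟨r + d' + 1, by omega, ?_, hunfold.1⟩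
  have := blockStart_mono Good hr'
  omega

/-- Suppose that the rows `y` are ordered by `key`, that each column `x` has fewer than `n`
alternations along this order, and that there is no splitting tree of height `ρ + 1`. Then
boundedly many equality tests decide the relation. The rows are cut greedily into intervals without
splitting trees of height `ρ`. If one column were constantly true on one such interval and its
successor row, and constantly false on another, it would be the root of a splitting tree that is too
tall. Hence each column has a default value, which it takes on all but boundedly many of the
intervals. -/
theorem eqDecides_of_alternation (n ρ : ℕ) : ∃ ι : Type, Finite ι ∧
    ∀ {X Y : Type} (P : X → Y → Prop) (A : Set X) (B : Set Y) (key : Y → ℕ), B.Finite →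
      (∀ y ∈ B, ∀ y' ∈ B, key y = key y' → ∀ x ∈ A, (P x y ↔ P x y')) →
      (∀ x ∈ A, ¬ ∃ r : Fin n → Y, (∀ i, r i ∈ B) ∧ StrictMono (fun i => key (r i)) ∧
        ∀ i, (P x (r i) ↔ Even (i : ℕ))) →
      ¬ SplitTree P A (ρ + 1) B → EqDecides ι A B P := by
  induction ρ with
  | zero =>
    refine ⟨Empty, inferInstance, fun {X Y} P A B key _ _ _ hT => ?_⟩
    refine ⟨fun _ e => e.elim, fun _ e => e.elim, fun x _ => ∃ y ∈ B, P x y, fun x hx y hy => ?_⟩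
    refine ⟨fun h => ⟨y, hy, h⟩, ?_⟩
    rintro ⟨y', hy', h⟩
    by_contra hn
    exact hT ⟨x, hx, ⟨y', hy', h⟩, ⟨y, hy, hn⟩⟩
  | succ ρ ih =>
    obtain ⟨ι, hι, ih⟩ := ih
    refine ⟨Fin (2 * n + 1) ⊕ Fin (2 * n + 1) × ι, inferInstance,
      fun {X Y} P A B key hBfin hkey halt hT => ?_⟩
    set Good : ℕ → ℕ → Prop :=
      fun b e => ¬ SplitTree P A (ρ + 1) {y ∈ B | b ≤ key y ∧ key y ≤ e} with hGood
    have good_self : ∀ r, Good r r := by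
      rintro r ⟨x, hx, h1, h2⟩
      obtain ⟨y1, ⟨hy1, hr1, hr1'⟩, hP1⟩ := h1.nonempty
      obtain ⟨y2, ⟨hy2, hr2, hr2'⟩, hP2⟩ := h2.nonempty
      exact hP2 ((hkey y1 hy1 y2 hy2 (by omega) x hx).1 hP1)
    -- `D x` says that `x` is constantly true on a block that is followed by another one.
    set D : X → Prop := fun x => ∃ r e, ¬ Good (blockStart Good r) e ∧
      ∀ y ∈ B, blockStart Good r ≤ key y → key y ≤ e → P x y with hD
    have both : ∀ x ∈ A, ∀ y ∈ B, ¬ (P x y ↔ D x) → ∀ e, key y ≤ e →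
        ¬ Good (blockStart Good (key y)) e → ∀ v : Prop, ∃ y' ∈ B,
          blockStart Good (key y) ≤ key y' ∧ key y' ≤ e ∧ (P x y' ↔ v) := by
      intro x hx y hy hne e hye hg v
      have hs := blockStart_le Good (key y)
      by_cases hv : (P x y ↔ v)
      · exact ⟨y, hy, hs, hye, hv⟩
      by_contra hcon
      push Not at hcon
      have hconst : ∀ y' ∈ B, blockStart Good (key y) ≤ key y' → key y' ≤ e →
          (P x y' ↔ P x y) := by
        intro y' hy' h1 h2
        have := hcon y' hy' h1 h2
        tauto
      by_cases hP : P x y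
      · exact hne (iff_of_true hP ⟨key y, e, hg, fun y' hy' h1 h2 => (hconst y' hy' h1 h2).2 hP⟩)
      · have hDx : D x := by tauto
        obtain ⟨r, e', hg', hall⟩ := hDx
        refine hT ⟨x, hx, ?_, ?_⟩
        · exact (not_not.1 hg').mono subset_rfl fun y' hy' =>
            ⟨hy'.1, hall y' hy'.1 hy'.2.1 hy'.2.2⟩
        · exact (not_not.1 hg).mono subset_rfl fun y' hy' =>
            ⟨hy'.1, fun h => hP ((hconst y' hy'.1 hy'.2.1 hy'.2.2).1 h)⟩
    -- The starting points of the blocks on which `x` deviates from its default value.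
    set Mixed : X → Set ℕ :=
      fun x => {b | ∃ y ∈ B, blockStart Good (key y) = b ∧ ¬ (P x y ↔ D x)} with hMixed
    have hcover : ∀ x ∈ A, ∃ f : Fin (2 * n + 1) → ℕ, Mixed x ⊆ Set.range f := by
      intro x hx
      rcases exists_strictMono_or_subset_range (Mixed x) (2 * n + 1) with ⟨s, hs, hmem⟩ | h
      · exfalso
        -- From each second mixed block one can choose a row with a prescribed value.
        have hsel : ∀ i : Fin n, ∃ y' ∈ B, s ⟨2 * i, by omega⟩ ≤ key y' ∧
            key y' ≤ s ⟨2 * i + 1, by omega⟩ ∧ (P x y' ↔ Even (i : ℕ)) := by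
          intro i
          obtain ⟨y, hy, hyb, hne⟩ := hmem ⟨2 * i, by omega⟩
          obtain ⟨z, hz, hzb, -⟩ := hmem ⟨2 * i + 1, by omega⟩
          have hlt : blockStart Good (key y) < blockStart Good (key z) := by
            rw [hyb, hzb]
            exact hs (by simp [Fin.lt_def])
          obtain ⟨e, he1, he2, hg⟩ := blockStart_next hlt
          obtain ⟨y', hy', h1, h2, h3⟩ := both x hx y hy hne e he1.le hg (Even (i : ℕ))
          exact ⟨y', hy', hyb ▸ h1, h2.trans (hzb ▸ he2), h3⟩
        choose r hr h1 h2 h3 using hsel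
        refine halt x hx ⟨r, hr, fun i j hij => ?_, h3⟩
        calc key (r i) ≤ s ⟨2 * i + 1, by omega⟩ := h2 i
          _ < s ⟨2 * j, by omega⟩ := hs (by simp only [Fin.lt_def] at hij ⊢; omega)
          _ ≤ key (r j) := h1 j
      · exact h
    classical
    choose! f hf using hcover
    refine EqDecides.gate f (fun y => blockStart Good (key y)) D ?_ ?_
    · intro x hx y hy hne
      by_contra hcon
      obtain ⟨i, hi⟩ := hf x hx (show blockStart Good (key y) ∈ Mixed x from ⟨y, hy, rfl, hcon⟩)
      exact hne i hi
    · intro c i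
      refine ih P _ _ key (hBfin.subset fun y hy => hy.1) ?_ ?_ ?_
      · exact fun y hy y' hy' h x hx => hkey y hy.1 y' hy'.1 h x hx.1
      · rintro x hx ⟨r, hr, h⟩
        exact halt x hx.1 ⟨r, fun i => (hr i).1, h⟩
      · intro htree
        obtain ⟨y, hy, hmax⟩ := Set.exists_max_image _ key
          (hBfin.subset fun y (hy : y ∈ {y ∈ B | blockStart Good (key y) = c}) => hy.1)
          htree.nonempty
        refine blockStart_good good_self (key y) (htree.mono (fun x hx => hx.1) fun y' hy' => ?_)
        refine ⟨hy'.1, ?_, hmax y' hy'⟩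
        have h1 := hy.2
        have h2 := hy'.2
        rw [h1, ← h2]
        exact blockStart_le _ _

/-! ### Ordered columns without alternating triples -/

/-- Ramsey's theorem for pairs of two colors. -/
theorem exists_ramsey_bound (p : ℕ) :
    ∀ q : ℕ, ∃ n, ∀ (c : ℕ → ℕ → Prop) (S : Finset ℕ), n ≤ S.card →
    (∃ T ⊆ S, T.card = p ∧ ∀ s ∈ T, ∀ t ∈ T, s < t → c s t) ∨
    (∃ T ⊆ S, T.card = q ∧ ∀ s ∈ T, ∀ t ∈ T, s < t → ¬ c s t) := by
  induction p with
  | zero => exact fun q => ⟨0, fun c S _ => Or.inl ⟨∅, by simp, by simp, by simp⟩⟩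
  | succ p ihp =>
    intro q
    induction q with
    | zero => exact ⟨0, fun c S _ => Or.inr ⟨∅, by simp, by simp, by simp⟩⟩
    | succ q ihq =>
      obtain ⟨n₁, h₁⟩ := ihp (q + 1)
      obtain ⟨n₂, h₂⟩ := ihq
      refine ⟨n₁ + n₂ + 1, fun c S hS => ?_⟩
      classical
      have hne : S.Nonempty := Finset.card_pos.1 (by omega)
      set m := S.min' hne
      have hm : m ∈ S := S.min'_mem hne
      have hlt : ∀ t ∈ S.erase m, m < t := fun t ht =>
        lt_of_le_of_ne (S.min'_le t (Finset.mem_of_mem_erase ht)) (Finset.ne_of_mem_erase ht).symm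
      have hsub : ∀ (φ : ℕ → Prop) [DecidablePred φ], (S.erase m).filter φ ⊆ S := fun φ _ =>
        (Finset.filter_subset _ _).trans (Finset.erase_subset _ _)
      have hcard := Finset.card_filter_add_card_filter_not (s := S.erase m) (c m)
      rw [Finset.card_erase_of_mem hm] at hcard
      have hins : ∀ (T : Finset ℕ) (d : ℕ → ℕ → Prop), T ⊆ (S.erase m).filter (d m) →
          (∀ s ∈ T, ∀ t ∈ T, s < t → d s t) → insert m T ⊆ S ∧ (insert m T).card = T.card + 1 ∧
          ∀ s ∈ insert m T, ∀ t ∈ insert m T, s < t → d s t := by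
        intro T d hT h
        have hmT : m ∉ T := fun hmem => by
          have := hT hmem
          simp at this
        refine ⟨Finset.insert_subset hm (hT.trans (hsub _)), Finset.card_insert_of_notMem hmT, ?_⟩
        intro s hs t ht hst
        rcases Finset.mem_insert.1 hs with rfl | hs <;> rcases Finset.mem_insert.1 ht with rfl | ht
        · exact absurd hst (lt_irrefl _)
        · exact (Finset.mem_filter.1 (hT ht)).2
        · exact absurd hst (not_lt.2 (hlt s (Finset.mem_filter.1 (hT hs)).1).le)
        · exact h s hs t ht hst
      by_cases hc : n₁ ≤ ((S.erase m).filter (c m)).card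
      · rcases h₁ c _ hc with ⟨T, hT, hTc, h⟩ | ⟨T, hT, hTc, h⟩
        · obtain ⟨h1, h2, h3⟩ := hins T c hT h
          exact Or.inl ⟨_, h1, by omega, h3⟩
        · exact Or.inr ⟨T, hT.trans (hsub _), hTc, h⟩
      · rcases h₂ c ((S.erase m).filter fun t => ¬ c m t) (by omega) with
          ⟨T, hT, hTc, h⟩ | ⟨T, hT, hTc, h⟩
        · exact Or.inl ⟨T, hT.trans (hsub _), hTc, h⟩
        · obtain ⟨h1, h2, h3⟩ := hins T (fun s t => ¬ c s t) (by convert hT) h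
          exact Or.inr ⟨_, h1, by omega, h3⟩

/-- The order `u` on the columns is such that no two rows `y`, `y'` have columns `x₁ ≤ x₂ ≤ x₃`
with `x₁` and `x₃` in `y` but not in `y'` and with `x₂` in `y'` but not in `y`. Point sets on one
side of pseudolines have this property with respect to the first coordinate. -/
def ABAFree {X Y : Type} (P : X → Y → Prop) (u : X → ℝ) (A : Set X) (B : Set Y) : Prop :=
  ∀ y ∈ B, ∀ y' ∈ B, ∀ x₁ ∈ A, ∀ x₂ ∈ A, ∀ x₃ ∈ A, u x₁ ≤ u x₂ → u x₂ ≤ u x₃ →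
    P x₁ y → ¬ P x₁ y' → P x₃ y → ¬ P x₃ y' → P x₂ y' → P x₂ y

/-- In a matrix with ordered rows and columns and without the pattern `[0 1; 1 0]`, whose rows are
pairwise incomparable, each column `z` alternates boundedly often unless there is a long chain. If
the rows `i₀ < j₀ < i₁ < j₁ < ⋯` contain `z` alternately, pick `q s` in the row `j s` but not in the
row `i (s + 1)`. Along a decreasing subsequence of `q` the rows `j`, and along an increasing one the
rows `i`, form a half-graph. -/
theorem exists_alternation_bound (k : ℕ) : ∃ n : ℕ,
    ∀ {X Y : Type} (P : X → Y → Prop) (u : X → ℝ) (A : Set X) (B : Set Y) (key : Y → ℕ),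
      (∀ y ∈ B, ∀ y' ∈ B, (∀ x ∈ A, P x y → P x y') → ∀ x ∈ A, P x y' → P x y) →
      (∀ y ∈ B, ∀ y' ∈ B, key y < key y' → ∀ p ∈ A, ∀ q ∈ A, u p ≤ u q →
        ¬ P p y → P q y → P p y' → P q y') →
      ¬ Chain P A B k →
      ∀ z ∈ A, ¬ ∃ r : Fin n → Y, (∀ i, r i ∈ B) ∧ StrictMono (fun i => key (r i)) ∧
        ∀ i, (P z (r i) ↔ Even (i : ℕ)) := by
  obtain ⟨n, hn⟩ := exists_ramsey_bound k k
  refine ⟨2 * n + 2, fun {X Y} P u A B key hanti hpat hch z hz => ?_⟩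
  rintro ⟨r, hr, hmono, halt⟩
  -- The rows that contain `z`, and those that do not.
  set i : ℕ → Y := fun s => if h : 2 * s < 2 * n + 2 then r ⟨2 * s, h⟩ else r 0 with hi
  set j : ℕ → Y := fun s => if h : 2 * s + 1 < 2 * n + 2 then r ⟨2 * s + 1, h⟩ else r 0 with hj
  have hiB : ∀ s, i s ∈ B := fun s => by simp only [hi]; split_ifs <;> exact hr _
  have hjB : ∀ s, j s ∈ B := fun s => by simp only [hj]; split_ifs <;> exact hr _
  have hie : ∀ s (h : s ≤ n), i s = r ⟨2 * s, by omega⟩ := fun s h => dif_pos (by omega)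
  have hje : ∀ s (h : s ≤ n), j s = r ⟨2 * s + 1, by omega⟩ := fun s h => dif_pos (by omega)
  have hzi : ∀ s ≤ n, P z (i s) := fun s h => by
    rw [hie s h, halt]
    simp
  have hzj : ∀ s ≤ n, ¬ P z (j s) := fun s h => by
    rw [hje s h, halt]
    simp
  have kij : ∀ s t, s ≤ t → t ≤ n → key (i s) < key (j t) := fun s t h h' => by
    rw [hie s (h.trans h'), hje t h']
    exact hmono (by simp only [Fin.lt_def]; omega)
  have kii : ∀ s t, s < t → t ≤ n → key (i s) < key (i t) := fun s t h h' => by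
    rw [hie s (h.le.trans h'), hie t h']
    exact hmono (by simp only [Fin.lt_def]; omega)
  have kji : ∀ s t, s < t → t ≤ n → key (j s) < key (i t) := fun s t h h' => by
    rw [hje s (h.le.trans h'), hie t h']
    exact hmono (by simp only [Fin.lt_def]; omega)
  have kjj : ∀ s t, s < t → t ≤ n → key (j s) < key (j t) := fun s t h h' => by
    rw [hje s (h.le.trans h'), hje t h']
    exact hmono (by simp only [Fin.lt_def]; omega)
  have hq : ∀ s, ∃ q, s < n → q ∈ A ∧ P q (j s) ∧ ¬ P q (i (s + 1)) := by
    intro s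
    by_cases hs : s < n
    · by_contra hcon
      push Not at hcon
      refine hzj s hs.le (hanti (j s) (hjB s) (i (s + 1)) (hiB _) ?_ z hz (hzi _ hs))
      intro x hx hxj
      by_contra hxi
      exact hxi ((hcon x).2 hx hxj)
    · exact ⟨z, fun h => absurd h hs⟩
  choose q hq using hq
  have hqz : ∀ s < n, u (q s) < u z := by
    intro s hs
    obtain ⟨hA, h1, h2⟩ := hq s hs
    by_contra hle
    exact h2 (hpat (j s) (hjB s) (i (s + 1)) (hiB _) (kji s _ (Nat.lt_succ_self s) hs) z hz (q s)
      hA (not_lt.1 hle) (hzj s hs.le) h1 (hzi _ hs))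
  have hleft : ∀ t s, t ≤ s → s ≤ n → ∀ x ∈ A, u x ≤ u z → P x (j s) → P x (i t) := by
    intro t s hts hs x hx hxz hxj
    by_contra hxi
    exact hzj s hs (hpat (i t) (hiB t) (j s) (hjB s) (kij t s hts hs) x hx z hz hxz hxi
      (hzi t (hts.trans hs)) hxj)
  have hqi : ∀ t s, t ≤ s → s < n → P (q s) (i t) := fun t s hts hs =>
    hleft t s hts hs.le (q s) (hq s hs).1 (hqz s hs).le (hq s hs).2.1
  have hqj : ∀ s t, s < t → t < n → ¬ P (q s) (j t) := fun s t hst ht hP =>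
    (hq s (hst.trans ht)).2.2 (hleft (s + 1) t hst ht.le (q s) (hq s (hst.trans ht)).1
      (hqz s (hst.trans ht)).le hP)
  rcases hn (fun s t => u (q t) ≤ u (q s)) (Finset.range n) (by simp) with
    ⟨T, hT, hTc, h⟩ | ⟨T, hT, hTc, h⟩
  · have hmem : ∀ a, T.orderEmbOfFin hTc a < n := fun a =>
      Finset.mem_range.1 (hT (T.orderEmbOfFin_mem hTc a))
    refine hch (Chain.of_reverse (fun a => q (T.orderEmbOfFin hTc a))
      (fun a => j (T.orderEmbOfFin hTc a)) (fun a => (hq _ (hmem a)).1) (fun a => hjB _) ?_)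
    intro a b hab
    have hlt : T.orderEmbOfFin hTc a < T.orderEmbOfFin hTc b :=
      (T.orderEmbOfFin hTc).strictMono hab
    have hu := h _ (T.orderEmbOfFin_mem hTc a) _ (T.orderEmbOfFin_mem hTc b) hlt
    refine ⟨?_, hqj _ _ hlt (hmem b)⟩
    by_contra hn'
    exact hqj _ _ hlt (hmem b) (hpat _ (hjB _) _ (hjB _) (kjj _ _ hlt (hmem b).le) _
      (hq _ (hmem b)).1 _ (hq _ (hmem a)).1 hu hn' (hq _ (hmem a)).2.1 (hq _ (hmem b)).2.1)
  · have hmem : ∀ a, T.orderEmbOfFin hTc a < n := fun a =>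
      Finset.mem_range.1 (hT (T.orderEmbOfFin_mem hTc a))
    refine hch (Chain.of_reverse (fun a => q (T.orderEmbOfFin hTc a))
      (fun a => i (T.orderEmbOfFin hTc a + 1)) (fun a => (hq _ (hmem a)).1) (fun a => hiB _) ?_)
    intro a b hab
    have hlt : T.orderEmbOfFin hTc a < T.orderEmbOfFin hTc b :=
      (T.orderEmbOfFin hTc).strictMono hab
    have hu := (not_le.1 (h _ (T.orderEmbOfFin_mem hTc a) _ (T.orderEmbOfFin_mem hTc b) hlt)).le
    have h1 := hqi (T.orderEmbOfFin hTc a + 1) (T.orderEmbOfFin hTc b) hlt (hmem b)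
    refine ⟨h1, fun hP => (hq _ (hmem b)).2.2 ?_⟩
    exact hpat _ (hiB _) _ (hiB _) (kii _ _ (Nat.succ_lt_succ hlt) (hmem b)) _ (hq _ (hmem a)).1 _
      (hq _ (hmem b)).1 hu (hq _ (hmem a)).2.2 h1 hP

/-- `y` is the top of a strictly increasing sequence of `n + 1` neighborhoods of elements
of `B`. -/
def HasHeight {X Y : Type} (P : X → Y → Prop) (A : Set X) (B : Set Y) : ℕ → Y → Prop
  | 0, y => y ∈ B
  | n + 1, y => y ∈ B ∧ ∃ y', HasHeight P A B n y' ∧ (∀ x ∈ A, P x y' → P x y) ∧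
      ∃ x ∈ A, P x y ∧ ¬ P x y'

theorem HasHeight.mem {X Y : Type} {P : X → Y → Prop} {A : Set X} {B : Set Y} {n : ℕ} {y : Y}
    (h : HasHeight P A B n y) : y ∈ B := by
  cases n with
  | zero => exact h
  | succ n => exact h.1

theorem HasHeight.chain {X Y : Type} {P : X → Y → Prop} {A : Set X} {B : Set Y} (n : ℕ) :
    ∀ {y : Y}, HasHeight P A B n y →
      Chain P {x ∈ A | P x y} {y' ∈ B | ∀ x ∈ A, P x y' → P x y} n := by
  induction n with
  | zero =>
    intro y h
    exact ⟨Fin.elim0, Fin.elim0, fun i => i.elim0, fun i => i.elim0, fun i => i.elim0⟩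
  | succ n ih =>
    rintro y ⟨hy, y', hy', hsub, x, hx, hxy, hxy'⟩
    refine (ih hy').snoc (fun x hx => ⟨hx.1, hsub _ hx.1 hx.2⟩)
      (fun z hz => ⟨hz.1, fun x hx h => hsub x hx (hz.2 x hx h)⟩) (x := x) (y := y') ⟨hx, hxy⟩
      ⟨hy'.mem, hsub⟩ (fun z hz h => hxy' (hz.2 x hx h)) fun z hz => hz.2

section Layer

variable {X Y : Type} {P : X → Y → Prop} {u : X → ℝ} {A : Set X} {B : Set Y}

/-- The left-to-right order of incomparable rows of an `ABAFree` relation. -/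
def LeftOf (P : X → Y → Prop) (u : X → ℝ) (A : Set X) (y y' : Y) : Prop :=
  ∃ p ∈ A, ∃ q ∈ A, P p y ∧ ¬ P p y' ∧ P q y' ∧ ¬ P q y ∧ u p < u q

theorem LeftOf.lt (hABA : ABAFree P u A B) {y y' : Y} (hy : y ∈ B) (hy' : y' ∈ B)
    (h : LeftOf P u A y y') {p q : X} (hp : p ∈ A) (hq : q ∈ A) (hpy : P p y) (hpy' : ¬ P p y')
    (hqy' : P q y') (hqy : ¬ P q y) : u p < u q := by
  obtain ⟨p₀, hp₀, q₀, hq₀, h1, h2, h3, h4, hlt⟩ := h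
  by_contra hle
  have hle := not_lt.1 hle
  rcases le_total (u q₀) (u p) with h5 | h5
  · exact h4 (hABA y hy y' hy' p₀ hp₀ q₀ hq₀ p hp hlt.le h5 h1 h2 hpy hpy' h3)
  · exact hpy' (hABA y' hy' y hy q hq p hp q₀ hq₀ hle h5 hqy' hqy h3 h4 hpy)

theorem LeftOf.total (hABA : ABAFree P u A B)
    (hanti : ∀ y ∈ B, ∀ y' ∈ B, (∀ x ∈ A, P x y → P x y') → ∀ x ∈ A, P x y' → P x y)
    {y y' : Y} (hy : y ∈ B) (hy' : y' ∈ B) :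
    (∀ x ∈ A, P x y ↔ P x y') ∨ LeftOf P u A y y' ∨ LeftOf P u A y' y := by
  by_cases h1 : ∀ x ∈ A, P x y → P x y'
  · exact Or.inl fun x hx => ⟨h1 x hx, hanti y hy y' hy' h1 x hx⟩
  by_cases h2 : ∀ x ∈ A, P x y' → P x y
  · exact Or.inl fun x hx => ⟨hanti y' hy' y hy h2 x hx, h2 x hx⟩
  push Not at h1 h2
  obtain ⟨p, hp, hpy, hpy'⟩ := h1
  obtain ⟨q, hq, hqy', hqy⟩ := h2
  rcases lt_trichotomy (u p) (u q) with h | h | h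
  · exact Or.inr (Or.inl ⟨p, hp, q, hq, hpy, hpy', hqy', hqy, h⟩)
  · exact absurd (hABA y hy y' hy' p hp q hq p hp h.le h.ge hpy hpy' hpy hpy' hqy') hqy
  · exact Or.inr (Or.inr ⟨q, hq, p, hp, hqy', hqy, hpy, hpy', h⟩)

theorem LeftOf.asymm (hABA : ABAFree P u A B) {y y' : Y} (hy : y ∈ B) (hy' : y' ∈ B)
    (h : LeftOf P u A y y') : ¬ LeftOf P u A y' y := by
  rintro ⟨p, hp, q, hq, h1, h2, h3, h4, hlt⟩
  exact absurd (h.lt hABA hy hy' hq hp h3 h4 h1 h2) (not_lt.2 hlt.le)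

theorem LeftOf.trans (hA : A.Finite) (hABA : ABAFree P u A B)
    (hanti : ∀ y ∈ B, ∀ y' ∈ B, (∀ x ∈ A, P x y → P x y') → ∀ x ∈ A, P x y' → P x y)
    {y₁ y₂ y₃ : Y} (hy₁ : y₁ ∈ B) (hy₂ : y₂ ∈ B) (hy₃ : y₃ ∈ B) (h₁₂ : LeftOf P u A y₁ y₂)
    (h₂₃ : LeftOf P u A y₂ y₃) : LeftOf P u A y₁ y₃ := by
  have h₁₂' := h₁₂
  have h₂₃' := h₂₃
  obtain ⟨p, hp, p', hp', h1, h2, h3, h4, hlt⟩ := h₁₂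
  obtain ⟨q, hq, q', hq', h5, h6, h7, h8, hlt'⟩ := h₂₃
  rcases LeftOf.total hABA hanti hy₁ hy₃ with h | h | h₃₁
  · have := h₁₂'.lt hABA hy₁ hy₂ hq' hq ((h q' hq').2 h7) h8 h5 (fun h' => h6 ((h q hq).1 h'))
    exact absurd this (not_lt.2 hlt'.le)
  · exact h
  · exfalso
    have h₃₁' := h₃₁
    obtain ⟨s, hs, s', hs', h9, h10, h11, h12, hlt''⟩ := h₃₁
    -- The leftmost column on which the three rows do not all agree.
    obtain ⟨m, hm, hmin⟩ := Set.exists_min_image {x ∈ A | ¬ ((P x y₁ ↔ P x y₂) ∧ (P x y₂ ↔ P x y₃))}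
      u (hA.subset fun x hx => hx.1) ⟨p, hp, by tauto⟩
    have hmA := hm.1
    have hm := hm.2
    by_cases m1 : P m y₁
    · by_cases m3 : P m y₃
      · have m2 : ¬ P m y₂ := by tauto
        exact absurd (h₂₃'.lt hABA hy₂ hy₃ hq hmA h5 h6 m3 m2)
          (not_lt.2 (hmin q ⟨hq, by tauto⟩))
      · exact absurd (h₃₁'.lt hABA hy₃ hy₁ hs hmA h9 h10 m1 m3)
          (not_lt.2 (hmin s ⟨hs, by tauto⟩))
    · by_cases m2 : P m y₂
      · exact absurd (h₁₂'.lt hABA hy₁ hy₂ hp hmA h1 h2 m2 m1)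
          (not_lt.2 (hmin p ⟨hp, by tauto⟩))
      · have m3 : P m y₃ := by tauto
        exact absurd (h₂₃'.lt hABA hy₂ hy₃ hq hmA h5 h6 m3 m2)
          (not_lt.2 (hmin q ⟨hq, by tauto⟩))

/-- Incomparable rows of an `ABAFree` relation can be numbered from left to right, and then the
pattern `[0 1; 1 0]` does not occur. -/
theorem exists_key (hA : A.Finite) (hB : B.Finite) (hABA : ABAFree P u A B)
    (hanti : ∀ y ∈ B, ∀ y' ∈ B, (∀ x ∈ A, P x y → P x y') → ∀ x ∈ A, P x y' → P x y) :
    ∃ key : Y → ℕ,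
      (∀ y ∈ B, ∀ y' ∈ B, key y = key y' → ∀ x ∈ A, (P x y ↔ P x y')) ∧
      (∀ y ∈ B, ∀ y' ∈ B, key y < key y' → ∀ p ∈ A, ∀ q ∈ A, u p ≤ u q →
        ¬ P p y → P q y → P p y' → P q y') := by
  classical
  set key : Y → ℕ := fun y => {z ∈ hB.toFinset | LeftOf P u A z y}.card with hkey
  have hmono : ∀ y ∈ B, ∀ y' ∈ B, LeftOf P u A y y' → key y < key y' := by
    intro y hy y' hy' h
    refine Finset.card_lt_card (Finset.ssubset_iff_of_subset ?_ |>.2 ⟨y, ?_, ?_⟩)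
    · intro z hz
      simp only [Finset.mem_filter, Set.Finite.mem_toFinset] at hz ⊢
      exact ⟨hz.1, hz.2.trans hA hABA hanti hz.1 hy hy' h⟩
    · simpa using ⟨hy, h⟩
    · simp only [Finset.mem_filter, not_and]
      exact fun _ h => h.asymm hABA hy hy h
  have hcongr : ∀ y y', (∀ x ∈ A, P x y ↔ P x y') → key y = key y' := by
    intro y y' h
    simp only [hkey]
    congr 1
    refine Finset.filter_congr fun z _ => ?_
    unfold LeftOf
    constructor <;> rintro ⟨p, hp, q, hq, h1, h2, h3, h4, hlt⟩
    · exact ⟨p, hp, q, hq, h1, fun h' => h2 ((h p hp).2 h'), (h q hq).1 h3, h4, hlt⟩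
    · exact ⟨p, hp, q, hq, h1, fun h' => h2 ((h p hp).1 h'), (h q hq).2 h3, h4, hlt⟩
  refine ⟨key, fun y hy y' hy' h => ?_, fun y hy y' hy' h p hp q hq hpq h1 h2 h3 => ?_⟩
  · rcases LeftOf.total hABA hanti hy hy' with h' | h' | h'
    · exact h'
    · exact absurd h (hmono y hy y' hy' h').ne
    · exact absurd h (hmono y' hy' y hy h').ne'
  · have hl : LeftOf P u A y y' := by
      rcases LeftOf.total hABA hanti hy hy' with h' | h' | h'
      · exact absurd (hcongr y y' h') h.ne
      · exact h'
      · exact absurd (hmono y' hy' y hy h') (not_lt.2 h.le)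
    by_contra h4
    exact absurd (hl.lt hABA hy hy' hq hp h2 h4 h3 h1) (not_lt.2 hpq)

end Layer

/-- An `ABAFree` relation without long chains is decided by boundedly many equality tests. Its rows
are cut into boundedly many layers of pairwise incomparable rows. In each layer the rows are linearly
ordered, and each column alternates boundedly often along this order. -/
theorem eqDecides_of_abaFree (k : ℕ) : ∃ ι : Type, Finite ι ∧
    ∀ {X Y : Type} [Finite X] [Finite Y] (P : X → Y → Prop) (u : X → ℝ) (A : Set X) (B : Set Y),
      ABAFree P u A B → ¬ Chain P A B k → EqDecides ι A B P := by
  obtain ⟨n, hn⟩ := exists_alternation_bound k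
  obtain ⟨ι, hι, h⟩ := eqDecides_of_alternation n (splitBound k)
  refine ⟨Fin (k + 1) ⊕ Fin (k + 1) × ι, inferInstance, fun {X Y} _ _ P u A B hABA hch => ?_⟩
  classical
  set ht : Y → ℕ := fun y => Nat.findGreatest (fun m => HasHeight P A B m y) k with hht
  have hlt : ∀ y ∈ B, ht y < k := by
    intro y hy
    refine lt_of_le_of_ne (Nat.findGreatest_le k) fun heq => hch ?_
    have hk : HasHeight P A B k y := by
      have := Nat.findGreatest_spec (P := fun m => HasHeight P A B m y) (Nat.zero_le k) hy
      rwa [show Nat.findGreatest (fun m => HasHeight P A B m y) k = k from heq] at this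
    exact (HasHeight.chain k hk).mono (fun x hx => hx.1) fun y hy => hy.1
  have hstrict : ∀ y ∈ B, ∀ y' ∈ B, (∀ x ∈ A, P x y → P x y') → (∃ x ∈ A, P x y' ∧ ¬ P x y) →
      ht y < ht y' := by
    intro y hy y' hy' h1 h2
    have hs : HasHeight P A B (ht y) y :=
      Nat.findGreatest_spec (P := fun m => HasHeight P A B m y) (Nat.zero_le k) hy
    exact Nat.le_findGreatest (hlt y hy) ⟨hy', y, hs, h1, h2⟩
  refine EqDecides.gate (fun _ i => i.1) ht (fun _ => False) ?_ ?_
  · intro x hx y hy hne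
    exact absurd rfl (hne ⟨ht y, (hlt y hy).trans (Nat.lt_succ_self k)⟩)
  · intro c i
    have hABA' : ABAFree P u A {y ∈ B | ht y = c} := fun y hy y' hy' =>
      hABA y hy.1 y' hy'.1
    have hch' : ¬ Chain P A {y ∈ B | ht y = c} k := fun h' =>
      hch (h'.mono subset_rfl fun y hy => hy.1)
    have hanti : ∀ y ∈ {y ∈ B | ht y = c}, ∀ y' ∈ {y ∈ B | ht y = c},
        (∀ x ∈ A, P x y → P x y') → ∀ x ∈ A, P x y' → P x y := by
      intro y hy y' hy' hsub x hx hxy'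
      by_contra hxy
      have := hstrict y hy.1 y' hy'.1 hsub ⟨x, hx, hxy', hxy⟩
      rw [hy.2, hy'.2] at this
      exact lt_irrefl _ this
    obtain ⟨key, hk1, hk2⟩ := exists_key (Set.toFinite A) (Set.toFinite _) hABA' hanti
    refine (h P A _ key (Set.toFinite _) hk1 (hn P u A _ key hanti hk2 hch') fun ht => ?_).mono
      (fun x hx => hx.1) subset_rfl
    rcases SplitTree.ramsey (A₁ := A) (A₂ := ∅) (by simp) _ (splitBound k) 1 _ rfl ht with ht | ht
    · exact hch' ht.chain
    · obtain ⟨x, hx, -⟩ := ht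
      exact hx

/-! ### Sign-rank at most three -/

theorem exists_factorization_of_rank_le {X Y : Type} [Finite X] [Fintype Y] (R : Matrix X Y ℝ)
    {d : ℕ} (h : R.rank ≤ d) :
    ∃ (a : X → Fin d → ℝ) (b : Y → Fin d → ℝ), ∀ x y, R x y = ∑ i, a x i * b y i := by
  classical
  have hW : Module.finrank ℝ (LinearMap.range R.mulVecLin) ≤ Module.finrank ℝ (Fin d → ℝ) := by
    simpa [Matrix.rank] using h
  obtain ⟨f, hf⟩ := (finrank_le_iff_exists_linearMap (R := ℝ)).1 hW
  obtain ⟨g, hg⟩ := f.exists_leftInverse_of_injective (LinearMap.ker_eq_bot.2 hf)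
  have hcol : ∀ y, R.col y ∈ LinearMap.range R.mulVecLin := fun y =>
    ⟨Pi.single y 1, by simp⟩
  refine ⟨fun x i => (g (fun j => if i = j then 1 else 0) : X → ℝ) x, fun y => f ⟨_, hcol y⟩,
    fun x y => ?_⟩
  have h1 : g (f ⟨_, hcol y⟩) = ⟨_, hcol y⟩ := LinearMap.congr_fun hg _
  have h2 := congrArg (fun w : LinearMap.range R.mulVecLin => (w : X → ℝ) x) h1
  rw [LinearMap.pi_apply_eq_sum_univ g] at h2
  have h3 : R x y = R.col y x := rfl
  refine h3.trans (h2.symm.trans ?_)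
  simp only [Submodule.coe_sum, Submodule.coe_smul, Finset.sum_apply, Pi.smul_apply, smul_eq_mul]
  exact Finset.sum_congr rfl fun i _ => mul_comm _ _

/-- If the third coordinates of the `a x` have the same sign and the second coordinates of the `b y`
have the same sign, then, after scaling, `x` is a point in the plane and `y` is a half-plane above
(or below) a line, and the points are ordered from left to right. -/
theorem abaFree_of_sign_eq {X Y : Type} (a : X → Fin 3 → ℝ) (b : Y → Fin 3 → ℝ) {A : Set X}
    {B : Set Y} (hA : ∀ x ∈ A, ∀ x' ∈ A, SignType.sign (a x 2) = SignType.sign (a x' 2))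
    (hB : ∀ y ∈ B, ∀ y' ∈ B, SignType.sign (b y 1) = SignType.sign (b y' 1)) :
    ABAFree (fun x y => 0 ≤ ∑ i, a x i * b y i)
      (fun x => if a x 2 = 0 then a x 0 else a x 0 / a x 2) A B := by
  intro y hy y' hy' x₁ hx₁ x₂ hx₂ x₃ hx₃ h12 h23 p1 p1' p3 p3' p2'
  by_contra p2
  simp only [Fin.sum_univ_three, not_le] at p1 p1' p3 p3' p2' p2
  -- Scale both half-planes so that their second coefficients agree.
  obtain ⟨l, l', hl, hl', hll⟩ : ∃ l l' : ℝ, 0 < l ∧ 0 < l' ∧ l * b y 1 = l' * b y' 1 := by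
    have hs := hB y hy y' hy'
    rcases lt_trichotomy (b y 1) 0 with h | h | h
    · rw [sign_neg h, eq_comm, sign_eq_neg_one_iff] at hs
      exact ⟨-b y' 1, -b y 1, by linarith, by linarith, by ring⟩
    · rw [h, sign_zero, eq_comm, sign_eq_zero_iff] at hs
      exact ⟨1, 1, one_pos, one_pos, by rw [h, hs]⟩
    · rw [sign_pos h, eq_comm, sign_eq_one_iff] at hs
      exact ⟨b y' 1, b y 1, hs, h, by ring⟩
  set d0 := l * b y 0 - l' * b y' 0 with hd0
  set d2 := l * b y 2 - l' * b y' 2 with hd2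
  have key : ∀ x, a x 0 * d0 + a x 2 * d2 = l * (a x 0 * b y 0 + a x 1 * b y 1 + a x 2 * b y 2) -
      l' * (a x 0 * b y' 0 + a x 1 * b y' 1 + a x 2 * b y' 2) := by
    intro x
    have : a x 1 * (l * b y 1) = a x 1 * (l' * b y' 1) := by rw [hll]
    linear_combination -this
  have q1 : 0 < a x₁ 0 * d0 + a x₁ 2 * d2 := by
    rw [key]
    have := mul_nonneg hl.le p1
    have := mul_neg_of_pos_of_neg hl' p1'
    linarith
  have q3 : 0 < a x₃ 0 * d0 + a x₃ 2 * d2 := by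
    rw [key]
    have := mul_nonneg hl.le p3
    have := mul_neg_of_pos_of_neg hl' p3'
    linarith
  have q2 : a x₂ 0 * d0 + a x₂ 2 * d2 < 0 := by
    rw [key]
    have := mul_nonneg hl'.le p2'
    have := mul_neg_of_pos_of_neg hl p2
    linarith
  -- An affine function of `u` cannot be positive at both ends and negative in between.
  have affine : ∀ u₁ u₂ u₃ e : ℝ, u₁ ≤ u₂ → u₂ ≤ u₃ → 0 < u₁ * d0 + e → 0 < u₃ * d0 + e →
      u₂ * d0 + e < 0 → False := by
    intro u₁ u₂ u₃ e h h' h1 h3 h2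
    rcases le_total 0 d0 with hd | hd
    · have := mul_le_mul_of_nonneg_right h hd
      linarith
    · have := mul_le_mul_of_nonpos_right h' hd
      linarith
  have affine' : ∀ u₁ u₂ u₃ e : ℝ, u₁ ≤ u₂ → u₂ ≤ u₃ → u₁ * d0 + e < 0 → u₃ * d0 + e < 0 →
      0 < u₂ * d0 + e → False := by
    intro u₁ u₂ u₃ e h h' h1 h3 h2
    rcases le_total 0 d0 with hd | hd
    · have := mul_le_mul_of_nonneg_right h' hd
      linarith
    · have := mul_le_mul_of_nonpos_right h hd
      linarith
  have hs1 := hA x₁ hx₁ x₂ hx₂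
  have hs3 := hA x₃ hx₃ x₂ hx₂
  have hdiv : ∀ x, a x 2 ≠ 0 → a x 0 * d0 + a x 2 * d2 = a x 2 * (a x 0 / a x 2 * d0 + d2) := by
    intro x hx
    field_simp
  rcases lt_trichotomy (a x₂ 2) 0 with h | h | h
  · rw [sign_neg h, sign_eq_neg_one_iff] at hs1 hs3
    simp only [h.ne, hs1.ne, hs3.ne, if_false] at h12 h23
    rw [hdiv _ h.ne] at q2
    rw [hdiv _ hs1.ne] at q1
    rw [hdiv _ hs3.ne] at q3
    exact affine' _ _ _ d2 h12 h23 (neg_of_mul_pos_right q1 hs1.le)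
      (neg_of_mul_pos_right q3 hs3.le) (pos_of_mul_neg_right q2 h.le)
  · rw [h, sign_zero, sign_eq_zero_iff] at hs1 hs3
    simp only [h, hs1, hs3, if_true] at h12 h23
    rw [h] at q2
    rw [hs1] at q1
    rw [hs3] at q3
    exact affine _ _ _ (0 * d2) h12 h23 q1 q3 q2
  · rw [sign_pos h, sign_eq_one_iff] at hs1 hs3
    simp only [h.ne', hs1.ne', hs3.ne', if_false] at h12 h23
    rw [hdiv _ h.ne'] at q2
    rw [hdiv _ hs1.ne'] at q1
    rw [hdiv _ hs3.ne'] at q3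
    exact affine _ _ _ d2 h12 h23 (pos_of_mul_pos_right q1 hs1.le)
      (pos_of_mul_pos_right q3 hs3.le) (neg_of_mul_neg_right q2 h.le)

/-- Rows and columns become vectors of dimension three. Alice knows the sign of a coordinate of her
vector, and finds out that of a coordinate of Bob's vector by equality tests. Once these two signs are
fixed, the relation is one between points and lines. -/
theorem eqDecides_of_rank_le_three (k : ℕ) : ∃ ι : Type, Finite ι ∧
    ∀ {X Y : Type} [Finite X] [Fintype Y] (R : Matrix X Y ℝ), R.rank ≤ 3 →
      ¬ Chain (fun x y => 0 ≤ R x y) .univ .univ k →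
      EqDecides ι .univ .univ fun x y => 0 ≤ R x y := by
  obtain ⟨ι, hι, h⟩ := eqDecides_of_abaFree k
  refine ⟨SignType × (SignType ⊕ SignType × ι), inferInstance, fun {X Y} _ _ R hR hch => ?_⟩
  obtain ⟨a, b, hab⟩ := exists_factorization_of_rank_le R hR
  simp only [hab] at hch ⊢
  obtain ⟨e, he⟩ := exists_injective_nat SignType
  refine EqDecides.cover_left (fun x => SignType.sign (a x 2)) fun t => ?_
  refine EqDecides.gate (fun _ i => e i) (fun y => e (SignType.sign (b y 1))) (fun _ => False)
    (fun x _ y _ hne => absurd rfl (hne _)) fun c i => ?_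
  refine h _ _ _ _ (abaFree_of_sign_eq a b ?_ ?_) fun h' =>
    hch (h'.mono (Set.subset_univ _) (Set.subset_univ _))
  · exact fun x hx x' hx' => hx.1.2.trans hx'.1.2.symm
  · exact fun y hy y' hy' => he (hy.2.trans hy'.2.symm)

/-! ### Unit disk graphs -/

theorem sqrt_four_sub_sq_add_le {s δ η : ℝ} (hδ : 0 ≤ δ) (hη : 0 ≤ η) (h1 : -2 ≤ s)
    (h2 : s + δ + η ≤ 2) : √(4 - s ^ 2) + √(4 - (s + δ + η) ^ 2) ≤
      √(4 - (s + δ) ^ 2) + √(4 - (s + η) ^ 2) := by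
  rcases (add_nonneg hδ hη).eq_or_lt with h0 | h0
  · obtain rfl : δ = 0 := by linarith
    obtain rfl : η = 0 := by linarith
    simp
  have hA : 0 ≤ 4 - s ^ 2 := by nlinarith
  have hB : 0 ≤ 4 - (s + δ + η) ^ 2 := by nlinarith
  have concave : ∀ p q : ℝ, 0 ≤ p → 0 ≤ q → p + q = 1 →
      p * √(4 - s ^ 2) + q * √(4 - (s + δ + η) ^ 2) ≤
        √(4 - (p * s + q * (s + δ + η)) ^ 2) := by
    intro p q hp hq hpq
    refine Real.le_sqrt_of_sq_le ?_
    have e1 := Real.sq_sqrt hA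
    have e2 := Real.sq_sqrt hB
    set α := √(4 - s ^ 2)
    set β := √(4 - (s + δ + η) ^ 2)
    have e3 : 0 ≤ p * q * ((α - β) ^ 2 + (s - (s + δ + η)) ^ 2) := by positivity
    obtain rfl : q = 1 - p := by linarith
    nlinarith
  have c1 := concave (η / (δ + η)) (δ / (δ + η)) (by positivity) (by positivity) (by field_simp; ring)
  have c2 := concave (δ / (δ + η)) (η / (δ + η)) (by positivity) (by positivity) (by field_simp)
  have e1 : η / (δ + η) * s + δ / (δ + η) * (s + δ + η) = s + δ := by field_simp; ring
  have e2 : δ / (δ + η) * s + η / (δ + η) * (s + δ + η) = s + η := by field_simp; ring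
  have e3 : η / (δ + η) + δ / (δ + η) = 1 := by field_simp; ring
  rw [e1] at c1
  rw [e2] at c2
  generalize √(4 - s ^ 2) = α at *
  generalize √(4 - (s + δ + η) ^ 2) = β at *
  have : α + β = (η / (δ + η) * α + δ / (δ + η) * β) + (δ / (δ + η) * α + η / (δ + η) * β) := by
    linear_combination (-(α + β)) * e3
  linarith

/-- Points above the centers `y` of disks of radius `2`, and so close to them horizontally that only
the upper half-circles matter: the vertical distance of two such half-circles is a monotone function
of the horizontal coordinate, so that they behave like pseudolines. -/
theorem abaFree_disk {X Y : Type} (u v : X → ℝ) (u' v' : Y → ℝ) {A : Set X} {B : Set Y}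
    (hv : ∀ x ∈ A, ∀ y ∈ B, 0 ≤ v x - v' y) (hu : ∀ x ∈ A, ∀ y ∈ B, |u x - u' y| ≤ 2) :
    ABAFree (fun x y => (u x - u' y) ^ 2 + (v x - v' y) ^ 2 < 4) u A B := by
  intro y hy y' hy' x₁ hx₁ x₂ hx₂ x₃ hx₃ h12 h23 p1 p1' p3 p3' p2'
  have iff : ∀ x ∈ A, ∀ z ∈ B, (u x - u' z) ^ 2 + (v x - v' z) ^ 2 < 4 ↔
      v x < v' z + √(4 - (u x - u' z) ^ 2) := by
    intro x hx z hz
    rw [← sub_lt_iff_lt_add', Real.lt_sqrt (hv x hx z hz)]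
    constructor <;> intro h <;> linarith
  simp only [iff _ hx₁ _ hy, iff _ hx₁ _ hy', iff _ hx₂ _ hy, iff _ hx₂ _ hy', iff _ hx₃ _ hy,
    iff _ hx₃ _ hy', not_lt] at *
  by_contra p2
  have mono : ∀ x ∈ A, ∀ x' ∈ A, u x ≤ u x' → ∀ z ∈ B, ∀ z' ∈ B, u' z ≤ u' z' →
      √(4 - (u x - u' z') ^ 2) + √(4 - (u x' - u' z) ^ 2) ≤
      √(4 - (u x - u' z) ^ 2) + √(4 - (u x' - u' z') ^ 2) := by
    intro x hx x' hx' hxx z hz z' hz' hzz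
    have := sqrt_four_sub_sq_add_le (s := u x - u' z') (δ := u' z' - u' z) (η := u x' - u x)
      (by linarith) (by linarith) (by linarith [(abs_le.1 (hu x hx z' hz')).1])
      (by linarith [(abs_le.1 (hu x' hx' z hz)).2])
    convert this using 4 <;> ring
  rcases le_total (u' y) (u' y') with h | h
  · have := mono x₂ hx₂ x₃ hx₃ h23 y hy y' hy' h
    linarith
  · have := mono x₁ hx₁ x₂ hx₂ h12 y' hy' y hy h
    linarith

/-- Two cells of side `1/2` of the square grid behave, with respect to disks of radius `2`, like
points and pseudolines, unless all their points are close to each other. -/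
theorem exists_abaFree_of_cells {X Y : Type} (p q : X → ℝ) (p' q' : Y → ℝ) {A : Set X} {B : Set Y}
    (hA : ∀ x ∈ A, ∀ z ∈ A, |p x - p z| < 1 / 2 ∧ |q x - q z| < 1 / 2)
    (hB : ∀ y ∈ B, ∀ z ∈ B, |p' y - p' z| < 1 / 2 ∧ |q' y - q' z| < 1 / 2)
    {x₀ : X} {y₀ : Y} (hx₀ : x₀ ∈ A) (hy₀ : y₀ ∈ B)
    (hfar : 4 ≤ (p x₀ - p' y₀) ^ 2 + (q x₀ - q' y₀) ^ 2) :
    ∃ u : X → ℝ, ABAFree (fun x y => (p x - p' y) ^ 2 + (q x - q' y) ^ 2 < 4) u A B := by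
  -- Rotate the plane so that the unit vector `(e, f)` from `y₀` to `x₀` points upwards.
  set L := √((p x₀ - p' y₀) ^ 2 + (q x₀ - q' y₀) ^ 2) with hL
  have hLsq : L ^ 2 = (p x₀ - p' y₀) ^ 2 + (q x₀ - q' y₀) ^ 2 := Real.sq_sqrt (by positivity)
  have hL2 : 2 ≤ L := Real.le_sqrt_of_sq_le (by linarith)
  have hL0 : L ≠ 0 := by positivity
  set e := (p x₀ - p' y₀) / L with he
  set f := (q x₀ - q' y₀) / L with hf
  have heL : p x₀ - p' y₀ = e * L := by rw [he]; field_simp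
  have hfL : q x₀ - q' y₀ = f * L := by rw [hf]; field_simp
  have hef : e ^ 2 + f ^ 2 = 1 := by
    have : (e ^ 2 + f ^ 2) * L ^ 2 = 1 * L ^ 2 := by
      rw [heL, hfL] at hLsq
      linarith
    exact mul_right_cancel₀ (pow_ne_zero 2 hL0) this
  have near : ∀ x ∈ A, ∀ y ∈ B, ∃ s t : ℝ, s ^ 2 + t ^ 2 ≤ 2 ∧ p x - p' y = e * L + s ∧
      q x - q' y = f * L + t := by
    intro x hx y hy
    refine ⟨(p x - p x₀) - (p' y - p' y₀), (q x - q x₀) - (q' y - q' y₀), ?_, ?_, ?_⟩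
    · obtain ⟨h1, h2⟩ := hA x hx x₀ hx₀
      obtain ⟨h3, h4⟩ := hB y hy y₀ hy₀
      rw [abs_lt] at h1 h2 h3 h4
      nlinarith
    · rw [← heL]; ring
    · rw [← hfL]; ring
  have habs : ∀ s t : ℝ, s ^ 2 + t ^ 2 ≤ 2 → |s * e + t * f| ≤ 2 ∧ |t * e - s * f| ≤ 2 := by
    intro s t hst
    have : (s * e + t * f) ^ 2 + (t * e - s * f) ^ 2 ≤ 2 := by
      calc _ = (s ^ 2 + t ^ 2) * (e ^ 2 + f ^ 2) := by ring
        _ ≤ 2 := by rw [hef]; linarith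
    constructor <;> refine abs_le_of_sq_le_sq ?_ (by norm_num) <;>
      nlinarith [sq_nonneg (s * e + t * f), sq_nonneg (t * e - s * f)]
  refine ⟨fun x => q x * e - p x * f, ?_⟩
  have key := abaFree_disk (fun x => q x * e - p x * f) (fun x => p x * e + q x * f)
    (fun y => q' y * e - p' y * f) (fun y => p' y * e + q' y * f) (A := A) (B := B) ?_ ?_
  · convert key using 4 with x y
    have : (p x - p' y) ^ 2 + (q x - q' y) ^ 2 =
      ((p x - p' y) ^ 2 + (q x - q' y) ^ 2) * (e ^ 2 + f ^ 2) := by rw [hef, mul_one]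
    rw [this]
    ring
  · intro x hx y hy
    obtain ⟨s, t, hst, h1, h2⟩ := near x hx y hy
    have h3 := (abs_le.1 (habs s t hst).1).1
    have : p x * e + q x * f - (p' y * e + q' y * f) = (e ^ 2 + f ^ 2) * L + (s * e + t * f) := by
      linear_combination e * h1 + f * h2
    simp only [this, hef]
    linarith
  · intro x hx y hy
    obtain ⟨s, t, hst, h1, h2⟩ := near x hx y hy
    have : q x * e - p x * f - (q' y * e - p' y * f) = t * e - s * f := by
      linear_combination e * h2 - f * h1
    simp only [this]
    exact (habs s t hst).2

/-- The plane is cut into square cells of side `1 / 2`, and adjacent vertices lie in cells whose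
coordinates differ by at most four. Equality tests reveal the relative position of the two cells,
and for two fixed cells either all distinct vertices are adjacent or, for a suitable direction in the
plane, the relation is `ABAFree`. -/
theorem eqDecides_of_isUnitDisk (k : ℕ) : ∃ ι : Type, Finite ι ∧
    ∀ {V : Type} [Finite V] (G : SimpleGraph V), IsUnitDisk G →
      (∀ A B : Set V, Disjoint A B → ¬ Chain G.Adj A B k) → EqDecides ι .univ .univ G.Adj := by
  obtain ⟨ι, hι, h⟩ := eqDecides_of_abaFree k
  refine ⟨(Fin 9 × Fin 9) ⊕ (Fin 9 × Fin 9) × Option ι, inferInstance,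
    fun {V} _ G ⟨φ, hφ⟩ hch => ?_⟩
  have hadj : ∀ x y, x ≠ y → (G.Adj x y ↔ (φ x 0 - φ y 0) ^ 2 + (φ x 1 - φ y 1) ^ 2 < 4) := by
    intro x y hxy
    rw [hφ x y hxy, EuclideanSpace.norm_eq, Real.sqrt_lt' (by norm_num)]
    simp only [Fin.sum_univ_two, PiLp.sub_apply, Real.norm_eq_abs, sq_abs]
    norm_num
  set cell : V → ℤ × ℤ := fun x => (⌊2 * φ x 0⌋, ⌊2 * φ x 1⌋) with hcell
  have floor_near : ∀ s t : ℝ, ⌊2 * s⌋ = ⌊2 * t⌋ → |s - t| < 1 / 2 := by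
    intro s t hst
    have := Int.abs_sub_lt_one_of_floor_eq_floor hst
    rw [← mul_sub, abs_mul, abs_of_pos (by norm_num : (0 : ℝ) < 2)] at this
    linarith
  have cell_near : ∀ x y, cell x = cell y →
      |φ x 0 - φ y 0| < 1 / 2 ∧ |φ x 1 - φ y 1| < 1 / 2 := fun x y hxy =>
    ⟨floor_near _ _ (congrArg Prod.fst hxy), floor_near _ _ (congrArg Prod.snd hxy)⟩
  refine EqDecides.gate
    (fun x i => Encodable.encode (cell x + ((i.1 : ℤ) - 4, (i.2 : ℤ) - 4)))
    (fun y => Encodable.encode (cell y)) (fun _ => False) ?_ ?_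
  · intro x _ y _ hne
    refine iff_of_false (fun hG => ?_) id
    have hlt := (hadj x y hG.ne).1 hG
    have floor_diff : ∀ s t : ℝ, (s - t) ^ 2 < 4 → ∃ i : Fin 9, ⌊2 * s⌋ + ((i : ℤ) - 4) = ⌊2 * t⌋ := by
      intro s t hst
      have h1 := abs_lt_of_sq_lt_sq' (show (s - t) ^ 2 < 2 ^ 2 by linarith) (by norm_num)
      have a1 := Int.floor_le (2 * s)
      have a2 := Int.lt_floor_add_one (2 * s)
      have a3 := Int.floor_le (2 * t)
      have a4 := Int.lt_floor_add_one (2 * t)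
      have b1 : (⌊2 * t⌋ : ℝ) < ⌊2 * s⌋ + 5 := by linarith
      have b2 : (⌊2 * s⌋ : ℝ) < ⌊2 * t⌋ + 5 := by linarith
      have b1 : ⌊2 * t⌋ < ⌊2 * s⌋ + 5 := by exact_mod_cast b1
      have b2 : ⌊2 * s⌋ < ⌊2 * t⌋ + 5 := by exact_mod_cast b2
      refine ⟨⟨(⌊2 * t⌋ - ⌊2 * s⌋ + 4).toNat, by omega⟩, ?_⟩
      simp only
      omega
    obtain ⟨i, hi⟩ := floor_diff (φ x 0) (φ y 0) (by nlinarith [sq_nonneg (φ x 1 - φ y 1)])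
    obtain ⟨j, hj⟩ := floor_diff (φ x 1) (φ y 1) (by nlinarith [sq_nonneg (φ x 0 - φ y 0)])
    refine hne (i, j) (congrArg _ ?_)
    exact Prod.ext hi hj
  · intro c i
    set A := {x ∈ (Set.univ : Set V) |
      Encodable.encode (cell x + ((i.1 : ℤ) - 4, (i.2 : ℤ) - 4)) = c} with hA
    set B := {y ∈ (Set.univ : Set V) | Encodable.encode (cell y) = c} with hB
    have hAc : ∀ x ∈ A, ∀ z ∈ A, cell x = cell z := fun x hx z hz =>
      add_right_cancel (Encodable.encode_injective (hx.2.trans hz.2.symm))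
    have hBc : ∀ x ∈ B, ∀ z ∈ B, cell x = cell z := fun x hx z hz =>
      Encodable.encode_injective (hx.2.trans hz.2.symm)
    by_cases hclose : ∀ x ∈ A, ∀ y ∈ B, (φ x 0 - φ y 0) ^ 2 + (φ x 1 - φ y 1) ^ 2 < 4
    -- The two cells may share vertices, so one more equality test has to detect `x = y`.
    · obtain ⟨n, ⟨e⟩⟩ := Finite.exists_equiv_fin V
      refine ⟨fun x _ => e x, fun y _ => e y, fun _ U => none ∉ U, fun x hx y hy => ?_⟩
      simp only [Set.mem_ofPred_eq, Fin.val_inj, e.injective.eq_iff]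
      exact ⟨fun hG => hG.ne, fun hne => (hadj x y hne).2 (hclose x hx y hy)⟩
    · push Not at hclose
      obtain ⟨x₀, hx₀, y₀, hy₀, hfar⟩ := hclose
      have hdisj : Disjoint A B := by
        rw [Set.disjoint_left]
        intro z hzA hzB
        obtain ⟨h1, h2⟩ := cell_near x₀ y₀ ((hAc _ hx₀ _ hzA).trans (hBc _ hzB _ hy₀))
        rw [abs_lt] at h1 h2
        nlinarith
      have hne : ∀ x ∈ A, ∀ y ∈ B, x ≠ y := fun x hx y hy hxy =>
        Set.disjoint_left.1 hdisj hx (hxy ▸ hy)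
      obtain ⟨u, hu⟩ := exists_abaFree_of_cells (fun x => φ x 0) (fun x => φ x 1) (fun x => φ x 0)
        (fun x => φ x 1) (fun x hx z hz => cell_near x z (hAc x hx z hz))
        (fun x hx z hz => cell_near x z (hBc x hx z hz)) hx₀ hy₀ hfar
      refine (h G.Adj u A B ?_ (hch A B hdisj)).extend some (Option.some_injective _)
      intro y hy y' hy' x₁ hx₁ x₂ hx₂ x₃ hx₃ h12 h23
      simp only [hadj _ _ (hne _ hx₁ _ hy), hadj _ _ (hne _ hx₁ _ hy'),
        hadj _ _ (hne _ hx₂ _ hy), hadj _ _ (hne _ hx₂ _ hy'),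
        hadj _ _ (hne _ hx₃ _ hy), hadj _ _ (hne _ hx₃ _ hy')]
      exact hu y hy y' hy' x₁ hx₁ x₂ hx₂ x₃ hx₃ h12 h23

/-! ### Randomized protocols from equality tests -/

open Classical in
/-- The sign matrix of a relation. -/
noncomputable def signMatrix {X Y : Type} (P : X → Y → Prop) : Matrix X Y ℤˣ :=
  fun x y => if P x y then 1 else -1

open Classical in
/-- A one-way protocol: Bob sends a message of `n` bits, and Alice announces the answer. -/
theorem exists_oneWay_protocol (n : ℕ) : ∀ {X Y : Type} (msg : Y → Fin n → Bool)
    (out : X → (Fin n → Bool) → Prop), ∃ p : Protocol X Y, p.cost ≤ n + 1 ∧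
      ∀ x y, p.run x y = if out x (msg y) then 1 else -1 := by
  induction n with
  | zero =>
    intro X Y msg out
    refine ⟨.alice (fun x => decide (out x Fin.elim0)) (.output (-1)) (.output 1), by
      simp [Protocol.cost], fun x y => ?_⟩
    rw [Subsingleton.elim (msg y) Fin.elim0]
    by_cases h : out x Fin.elim0 <;> simp [Protocol.run, h]
  | succ n ih =>
    intro X Y msg out
    choose p hcost hrun using fun b : Bool =>
      ih (fun y => Fin.tail (msg y)) fun (x : X) v => out x (Fin.cons b v)
    refine ⟨.bob (fun y => msg y 0) (p false) (p true), ?_, fun x y => ?_⟩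
    · simp only [Protocol.cost]
      have := hcost false
      have := hcost true
      omega
    · have hrun' : (Protocol.bob (fun y => msg y 0) (p false) (p true)).run x y =
          (p (msg y 0)).run x y := by
        cases h : msg y 0 <;> simp [Protocol.run, h]
      rw [hrun', hrun, Fin.cons_self_tail]

/-- A random function takes the same value at two distinct points with probability at most
`1 / Fintype.card Q`. -/
theorem card_collision_mul_le {α Q : Type} [Fintype α] [DecidableEq α] [Fintype Q] [DecidableEq Q]
    {a b : α} (hab : a ≠ b) :
    {h : α → Q | h a = h b}.ncard * Fintype.card Q ≤ Fintype.card (α → Q) := by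
  rw [← Nat.card_coe_set_eq, ← Nat.card_eq_fintype_card, ← Nat.card_eq_fintype_card,
    ← Nat.card_prod]
  refine Nat.card_le_card_of_injective
    (fun z : {h : α → Q | h a = h b} × Q => Function.update z.1.1 b z.2) ?_
  rintro ⟨⟨h, hh⟩, c⟩ ⟨⟨h', hh'⟩, c'⟩ heq
  simp only at heq
  have hh : h a = h b := hh
  have hh' : h' a = h' b := hh'
  have h1 : ∀ z, z ≠ b → h z = h' z := fun z hz => by
    simpa [hz] using congrFun heq z
  have h2 : c = c' := by simpa using congrFun heq b
  have h3 : h = h' := funext fun z => by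
    by_cases hz : z = b
    · rw [hz, ← hh, ← hh', h1 a hab]
    · exact h1 z hz
  subst h2 h3
  rfl

/-- Equality tests have public-coin protocols of constant cost: the players compare random hash
values. -/
theorem exists_computesWithCost_of_eqDecides (ι : Type) [Finite ι] : ∃ c : ℕ,
    ∀ {X Y : Type} [Finite X] [Finite Y] (P : X → Y → Prop), EqDecides ι .univ .univ P →
      ∃ μ, ComputesWithCost (signMatrix P) μ c := by
  classical
  have := Fintype.ofFinite ι
  set q := Fintype.card ι with hq
  set t := 3 * q with ht
  refine ⟨Fintype.card (ι × Fin t) + 1, fun {X Y} _ _ P ⟨f, g, F, hP⟩ => ?_⟩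
  obtain ⟨n, hn⟩ : ∃ n : ℕ, (∀ x i, f x i < n) ∧ ∀ y i, g y i < n := by
    obtain ⟨M, hM⟩ := (Set.finite_range fun z : X × ι => f z.1 z.2).bddAbove
    obtain ⟨M', hM'⟩ := (Set.finite_range fun z : Y × ι => g z.1 z.2).bddAbove
    refine ⟨M + M' + 1, fun x i => ?_, fun y i => ?_⟩
    · have : f x i ≤ M := hM ⟨(x, i), rfl⟩
      omega
    · have : g y i ≤ M' := hM' ⟨(y, i), rfl⟩
      omega
  set e := Fintype.equivFin (ι × Fin t)
  set fh : (Fin n → Fin t → Bool) → X → ι → Fin t → Bool := fun h x i => h ⟨f x i, hn.1 x i⟩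
  set gh : (Fin n → Fin t → Bool) → Y → ι → Fin t → Bool := fun h y i => h ⟨g y i, hn.2 y i⟩
  choose p hcost hrun using fun h : Fin n → Fin t → Bool => exists_oneWay_protocol
    (Fintype.card (ι × Fin t)) (fun y j => gh h y (e.symm j).1 (e.symm j).2)
    fun x v => F x {i | ∀ j, fh h x i j = v (e (i, j))}
  refine ⟨(PMF.uniformOfFintype (Fin n → Fin t → Bool)).map p, ?_, fun x y => ?_⟩
  · intro p' hp'
    rw [PMF.support_map] at hp'
    obtain ⟨h, -, rfl⟩ := hp'
    exact hcost h
  rw [PMF.toOuterMeasure_map_apply, PMF.toOuterMeasure_uniformOfFintype_apply]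
  -- The hash function `h` is bad if it identifies different values that are to be compared.
  set bad : Set (Fin n → Fin t → Bool) := ⋃ i : ι, {h | f x i ≠ g y i ∧ fh h x i = gh h y i}
    with hbad
  have hgood : badᶜ ⊆ p ⁻¹' {p | p.run x y = signMatrix P x y} := by
    intro h hh
    simp only [hbad, Set.mem_compl_iff, Set.mem_iUnion, Set.mem_ofPred_eq, not_exists, not_and,
      ne_eq] at hh
    simp only [Set.mem_preimage, Set.mem_ofPred_eq, hrun, signMatrix, hP x trivial y trivial]
    have hset : {i | ∀ j, fh h x i j = gh h y (e.symm (e (i, j))).1 (e.symm (e (i, j))).2} =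
        {i | f x i = g y i} := by
      ext i
      simp only [Equiv.symm_apply_apply, Set.mem_ofPred_eq]
      constructor
      · intro h'
        by_contra hne
        exact hh i hne (funext h')
      · intro h' j
        simp only [fh, gh, h']
    rw [hset]
  have hbadcard : 3 * bad.ncard ≤ Fintype.card (Fin n → Fin t → Bool) := by
    have h1 : ∀ i : ι, {h | f x i ≠ g y i ∧ fh h x i = gh h y i}.ncard * 2 ^ t ≤
        Fintype.card (Fin n → Fin t → Bool) := by
      intro i
      by_cases hi : f x i = g y i
      · simp [hi]
      · have := card_collision_mul_le (Q := Fin t → Bool) (α := Fin n) (a := ⟨f x i, hn.1 x i⟩)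
          (b := ⟨g y i, hn.2 y i⟩) (by simpa using hi)
        simpa [hi, fh, gh] using this
    have h2 : bad.ncard ≤ ∑ i : ι, {h | f x i ≠ g y i ∧ fh h x i = gh h y i}.ncard := by
      have : bad = ↑(Finset.univ.biUnion fun i : ι =>
          {h | f x i ≠ g y i ∧ fh h x i = gh h y i}.toFinset) := by
        simp [hbad]
      rw [this, Set.ncard_coe_finset]
      refine Finset.card_biUnion_le.trans_eq (Finset.sum_congr rfl fun i _ => ?_)
      rw [Set.ncard_eq_toFinset_card']
    have h3 : bad.ncard * 2 ^ t ≤ q * Fintype.card (Fin n → Fin t → Bool) := by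
      calc bad.ncard * 2 ^ t
          ≤ ∑ i : ι, {h | f x i ≠ g y i ∧ fh h x i = gh h y i}.ncard * 2 ^ t := by
            rw [← Finset.sum_mul]
            exact Nat.mul_le_mul_right _ h2
        _ ≤ ∑ _i : ι, Fintype.card (Fin n → Fin t → Bool) := Finset.sum_le_sum fun i _ => h1 i
        _ = _ := by simp [hq]
    have h4 : 3 * q ≤ 2 ^ t := ht ▸ Nat.lt_two_pow_self.le
    refine Nat.le_of_mul_le_mul_right (c := 2 ^ t) ?_ (by positivity)
    calc 3 * bad.ncard * 2 ^ t = 3 * (bad.ncard * 2 ^ t) := by ring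
      _ ≤ 3 * (q * Fintype.card (Fin n → Fin t → Bool)) := Nat.mul_le_mul_left _ h3
      _ = Fintype.card (Fin n → Fin t → Bool) * (3 * q) := by ring
      _ ≤ _ := Nat.mul_le_mul_left _ h4
  have hcompl := Set.ncard_add_ncard_compl bad
  have hle := Set.ncard_le_ncard hgood
  rw [Nat.card_eq_fintype_card] at hcompl
  rw [← Nat.card_eq_fintype_card, Nat.card_coe_set_eq,
    ENNReal.le_div_iff_mul_le (Or.inl (by simp)) (Or.inl (by simp)), mul_comm, ← mul_div_assoc,
    ENNReal.div_le_iff (by norm_num) (by norm_num)]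
  have : Fintype.card (Fin n → Fin t → Bool) * 2 ≤
      (p ⁻¹' {p | p.run x y = signMatrix P x y}).ncard * 3 := by omega
  exact_mod_cast this

/-- The infimum in the definition of `randCC` is attained, since the matrix is finite. -/
theorem exists_computesWithCost_of_randCC_le {X Y : Type} [Finite X] [Finite Y] {P : X → Y → Prop}
    {c : ℕ} (h : randCC (signMatrix P) ≤ c) : ∃ μ, ComputesWithCost (signMatrix P) μ c := by
  obtain ⟨n, hn⟩ := EqDecides.of_finite P
  obtain ⟨c', hc'⟩ := exists_computesWithCost_of_eqDecides (Fin n)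
  obtain ⟨μ, hμ, hμ'⟩ : ∃ μ, ComputesWithCost (signMatrix P) μ (randCC (signMatrix P)) :=
    Nat.sInf_mem (s := {c | ∃ μ, ComputesWithCost (signMatrix P) μ c}) ⟨c', hc' P hn⟩
  exact ⟨μ, fun p hp => (hμ p hp).trans h, hμ'⟩

/-! ### Implicit representations from equality tests -/

theorem exists_injOn_fin {S : Set ℕ} {n : ℕ} (hn : 0 < n) (hS : S.Finite) (h : S.ncard ≤ n) :
    ∃ c : ℕ → Fin n, Set.InjOn c S := by
  classical
  have : Nonempty (S ↪ Fin n) := by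
    have := hS.fintype
    refine Function.Embedding.nonempty_of_card_le ?_
    rwa [Fintype.card_fin, ← Nat.card_eq_fintype_card, Nat.card_coe_set_eq]
  obtain ⟨e⟩ := this
  refine ⟨fun v => if hv : v ∈ S then e ⟨v, hv⟩ else ⟨0, hn⟩, fun v hv w hw h => ?_⟩
  simp only [hv, hw, dif_pos] at h
  exact congrArg Subtype.val (e.injective h)

/-- The label of a vertex consists of the truth table of the answer and of the values that the vertex
would compare, in the role of either player. On `N` vertices the values can be renamed to at most a
linear number of values, each of `O(log N)` bits. -/
theorem exists_labels (ι : Type) [Finite ι] :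
    ∃ (D : List Bool → List Bool → Bool) (ℓ : ℕ → ℕ),
      (fun N => (ℓ N : ℝ)) =O[atTop] (fun N : ℕ => Real.log N) ∧
      ∀ {W : Type} [Fintype W] (P : W → W → Prop), EqDecides ι .univ .univ P →
        ∃ enc : W → List Bool, (∀ w, (enc w).length ≤ ℓ (Fintype.card W)) ∧
          ∀ w z, D (enc w) (enc z) = true ↔ P w z := by
  classical
  have := Fintype.ofFinite ι
  set q := Fintype.card ι with hq
  -- The labels of level `s` can be written with `len s` bits, so that `s` is known to the decoder.
  let Lab : ℕ → Type := fun s => (Set ι → Bool) × (ι → Fin (2 ^ s)) × (ι → Fin (2 ^ s))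
  set len : ℕ → ℕ := fun s => 2 ^ q + s * q + s * q + s with hlen
  have len_inj : Function.Injective len := by
    have : StrictMono len := strictMono_nat_of_lt_succ fun s => by simp only [hlen]; nlinarith
    exact this.injective
  have hemb : ∀ s, Nonempty (Lab s ↪ (Fin (len s) → Bool)) := by
    intro s
    refine Function.Embedding.nonempty_of_card_le ?_
    simp only [Lab, Fintype.card_prod, Fintype.card_pi, Fintype.card_bool, Fintype.card_fin,
      Finset.prod_const, Finset.card_univ, Fintype.card_set, ← hq]
    rw [← pow_mul, ← pow_add, ← pow_add]
    exact Nat.pow_le_pow_right (by norm_num) (by simp only [hlen]; omega)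
  let E : ∀ s, Lab s ↪ (Fin (len s) → Bool) := fun s => Classical.choice (hemb s)
  let code : ∀ s, Lab s → List Bool := fun s d => List.ofFn (E s d)
  let rel : ∀ s, Lab s → Lab s → Prop := fun s d d' => d.1 {i | d.2.1 i = d'.2.2 i} = true
  have hcode : ∀ s s' d d', code s d = code s' d' → s = s' := fun s s' d d' h => by
    have := congrArg List.length h
    simp only [code, List.length_ofFn] at this
    exact len_inj this
  have hcode' : ∀ s d d', code s d = code s d' → d = d' := fun s d d' h =>
    (E s).injective (List.ofFn_injective h)
  refine ⟨fun w z => decide (∃ s, ∃ d d' : Lab s, w = code s d ∧ z = code s d' ∧ rel s d d'),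
    fun N => len (Nat.log 2 N + 2), ?_, ?_⟩
  · refine IsBigO.of_bound (2 ^ q + (2 * q + 1) * (1 / Real.log 2 + 2)) ?_
    filter_upwards [eventually_ge_atTop 3] with N hN
    have h1 : 1 ≤ Real.log N := by
      rw [Real.le_log_iff_exp_le (by positivity)]
      have : (3 : ℝ) ≤ N := by exact_mod_cast hN
      linarith [Real.exp_one_lt_three]
    have h2 : (Nat.log 2 N : ℝ) ≤ Real.log N / Real.log 2 := by
      have := Real.natLog_le_logb N 2
      simpa [Real.logb] using this
    rw [Real.norm_of_nonneg (by positivity), Real.norm_of_nonneg (by linarith)]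
    have h3 : ((len (Nat.log 2 N + 2) : ℕ) : ℝ) = 2 ^ q + (2 * q + 1) * (Nat.log 2 N + 2) := by
      simp only [hlen]
      push_cast
      ring
    rw [h3, add_mul, mul_assoc, add_mul]
    have h4 : (2 : ℝ) ^ q ≤ 2 ^ q * Real.log N := le_mul_of_one_le_right (by positivity) h1
    have h5 : (Nat.log 2 N + 2 : ℝ) ≤ 1 / Real.log 2 * Real.log N + 2 * Real.log N := by
      rw [one_div_mul_eq_div]
      linarith
    have h6 : (0 : ℝ) ≤ 2 * q + 1 := by positivity
    linarith [mul_le_mul_of_nonneg_left h5 h6]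
  · intro W _ P ⟨f, g, F, h⟩
    set s := Nat.log 2 (Fintype.card W) + 2 with hs
    have hcard : 2 * Fintype.card W ≤ 2 ^ s := by
      have := (Nat.lt_pow_succ_log_self (b := 2) (by norm_num) (Fintype.card W)).le
      rw [hs, pow_succ]
      simp only [Nat.succ_eq_add_one] at this
      omega
    have hcompress : ∀ i, ∃ c : ℕ → Fin (2 ^ s),
        Set.InjOn c (Set.range (fun w => f w i) ∪ Set.range fun w => g w i) := by
      intro i
      refine exists_injOn_fin (by positivity) ((Set.finite_range _).union (Set.finite_range _)) ?_
      refine (Set.ncard_union_le _ _).trans (le_trans ?_ hcard)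
      have hr : ∀ φ : W → ℕ, (Set.range φ).ncard ≤ Fintype.card W := fun φ => by
        rw [← Set.image_univ, ← Nat.card_eq_fintype_card, ← Set.ncard_univ]
        exact Set.ncard_image_le
      have := hr fun w => f w i
      have := hr fun w => g w i
      omega
    choose c hc using hcompress
    let lab : W → Lab s := fun w =>
      (fun U => decide (F w U), fun i => c i (f w i), fun i => c i (g w i))
    have hrel : ∀ w z, rel s (lab w) (lab z) ↔ P w z := by
      intro w z
      simp only [rel, lab, decide_eq_true_eq]
      rw [h w trivial z trivial]
      have hset : {i | c i (f w i) = c i (g z i)} = {i | f w i = g z i} := by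
        ext i
        exact (hc i).eq_iff (Or.inl ⟨w, rfl⟩) (Or.inr ⟨z, rfl⟩)
      rw [hset]
    refine ⟨fun w => code s (lab w), fun w => List.length_ofFn.le, fun w z => ?_⟩
    rw [decide_eq_true_eq, ← hrel]
    constructor
    · rintro ⟨s', d, d', h1, h2, h3⟩
      obtain rfl := hcode _ _ _ _ h1
      rwa [hcode' _ _ _ h1, hcode' _ _ _ h2]
    · exact fun h => ⟨s, lab w, lab z, rfl, rfl, h⟩

/-! ### Greater-Than is hard for randomized protocols -/

/-- Weights of the pairs `(i, j)` with `s ≤ i, j < s + 2 ^ m`: if `m` levels of dyadic intervals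
are considered, the weight is inversely proportional to the length of the smallest dyadic interval
that contains both `i` and `j`, with positive sign for `i < j` and negative sign for `j < i`. -/
noncomputable def gtWeight : ℕ → ℕ → ℕ → ℕ → ℝ
  | 0, _, _, _ => 0
  | m + 1, s, i, j => gtWeight m s i j + gtWeight m (s + 2 ^ m) i j +
      (1 / 2 ^ m) *
        ((if i ∈ Finset.Ico s (s + 2 ^ m) then 1 else 0) *
            (if j ∈ Finset.Ico (s + 2 ^ m) (s + 2 ^ m + 2 ^ m) then 1 else 0) -
          (if i ∈ Finset.Ico (s + 2 ^ m) (s + 2 ^ m + 2 ^ m) then 1 else 0) *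
            (if j ∈ Finset.Ico s (s + 2 ^ m) then 1 else 0))

theorem gtWeight_nonneg (m : ℕ) : ∀ {s i j : ℕ}, i < j → 0 ≤ gtWeight m s i j := by
  induction m with
  | zero => exact fun _ => le_rfl
  | succ m ih =>
    intro s i j hij
    have h : ¬ (i ∈ Finset.Ico (s + 2 ^ m) (s + 2 ^ m + 2 ^ m) ∧ j ∈ Finset.Ico s (s + 2 ^ m)) := by
      simp only [Finset.mem_Ico]
      omega
    have h' : (if i ∈ Finset.Ico (s + 2 ^ m) (s + 2 ^ m + 2 ^ m) then (1 : ℝ) else 0) *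
        (if j ∈ Finset.Ico s (s + 2 ^ m) then 1 else 0) = 0 := by
      rcases not_and_or.1 h with h | h <;> simp only [if_neg h, zero_mul, mul_zero]
    rw [gtWeight, h', sub_zero]
    have h1 := ih (s := s) hij
    have h2 := ih (s := s + 2 ^ m) hij
    positivity

theorem gtWeight_antisymm (m : ℕ) : ∀ s i j : ℕ, gtWeight m s j i = -gtWeight m s i j := by
  induction m with
  | zero => simp [gtWeight]
  | succ m ih =>
    intro s i j
    rw [gtWeight, gtWeight, ih s i j, ih (s + 2 ^ m) i j]
    ring

/-- The sum of the entries of `M`, weighted by `gtWeight`. -/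
noncomputable def gtSum (n m s : ℕ) (M : ℕ → ℕ → ℝ) : ℝ :=
  ∑ i ∈ Finset.range n, ∑ j ∈ Finset.range n, gtWeight m s i j * M i j

theorem gtSum_succ {n m s : ℕ} (h : s + 2 ^ (m + 1) ≤ n) (M : ℕ → ℕ → ℝ) :
    gtSum n (m + 1) s M = gtSum n m s M + gtSum n m (s + 2 ^ m) M + (1 / 2 ^ m) *
      (∑ i ∈ Finset.Ico s (s + 2 ^ m), ∑ j ∈ Finset.Ico (s + 2 ^ m) (s + 2 ^ m + 2 ^ m), M i j -
        ∑ i ∈ Finset.Ico (s + 2 ^ m) (s + 2 ^ m + 2 ^ m), ∑ j ∈ Finset.Ico s (s + 2 ^ m),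
          M i j) := by
  have hsub1 : Finset.Ico s (s + 2 ^ m) ⊆ Finset.range n := fun i hi => by
    simp only [Finset.mem_Ico, Finset.mem_range, pow_succ] at *
    omega
  have hsub2 : Finset.Ico (s + 2 ^ m) (s + 2 ^ m + 2 ^ m) ⊆ Finset.range n := fun i hi => by
    simp only [Finset.mem_Ico, Finset.mem_range, pow_succ] at *
    omega
  have hrect : ∀ S T : Finset ℕ, S ⊆ Finset.range n → T ⊆ Finset.range n →
      ∑ i ∈ Finset.range n, ∑ j ∈ Finset.range n,
        (if i ∈ S then 1 else 0) * (if j ∈ T then 1 else 0) * M i j =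
      ∑ i ∈ S, ∑ j ∈ T, M i j := by
    intro S T hS hT
    simp only [ite_mul, one_mul, zero_mul, Finset.sum_ite_mem, Finset.inter_eq_right.2 hT,
      Finset.sum_ite_irrel, Finset.sum_const_zero, Finset.inter_eq_right.2 hS]
  rw [← hrect _ _ hsub1 hsub2, ← hrect _ _ hsub2 hsub1]
  simp only [gtSum, gtWeight, Finset.mul_sum, ← Finset.sum_add_distrib, ← Finset.sum_sub_distrib]
  refine Finset.sum_congr rfl fun i _ => Finset.sum_congr rfl fun j _ => ?_
  ring

/-- The total weight of all pairs. -/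
theorem gtSum_sign {n : ℕ} (m : ℕ) : ∀ s, s + 2 ^ m ≤ n →
    gtSum n m s (fun i j => if i < j then 1 else -1) = m * 2 ^ m := by
  induction m with
  | zero => simp [gtSum, gtWeight]
  | succ m ih =>
    intro s hs
    have hpow : 2 ^ (m + 1) = 2 ^ m + 2 ^ m := by ring
    have hpos : 0 < 2 ^ m := Nat.two_pow_pos m
    rw [gtSum_succ hs, ih s (by omega), ih (s + 2 ^ m) (by omega)]
    have h1 : ∑ i ∈ Finset.Ico s (s + 2 ^ m), ∑ j ∈ Finset.Ico (s + 2 ^ m) (s + 2 ^ m + 2 ^ m),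
        (if i < j then (1 : ℝ) else -1) = 2 ^ m * 2 ^ m := by
      rw [Finset.sum_congr rfl fun i hi => Finset.sum_congr rfl fun j hj => if_pos (by
        simp only [Finset.mem_Ico] at hi hj
        omega)]
      simp
    have h2 : ∑ i ∈ Finset.Ico (s + 2 ^ m) (s + 2 ^ m + 2 ^ m), ∑ j ∈ Finset.Ico s (s + 2 ^ m),
        (if i < j then (1 : ℝ) else -1) = -(2 ^ m * 2 ^ m) := by
      rw [Finset.sum_congr rfl fun i hi => Finset.sum_congr rfl fun j hj => if_neg (by
        simp only [Finset.mem_Ico] at hi hj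
        omega)]
      simp
    rw [h1, h2]
    push_cast
    field_simp
    ring

/-- Rectangles have small weight. The error term bounds the contribution of each level of dyadic
intervals by the increments of the densities of `α` and `β` on that level, and the squares of these
increments telescope. -/
theorem abs_gtSum_le {n : ℕ} {c : ℝ} (hc : 0 < c) {α β : ℕ → ℝ} (hα : ∀ i, |α i| ≤ 1)
    (hβ : ∀ i, |β i| ≤ 1) (m : ℕ) : ∀ s, s + 2 ^ m ≤ n →
    |gtSum n m s (fun i j => α i * β j)| ≤ m * 2 ^ m / (4 * c) + 2 * c * (2 * 2 ^ m -
      (∑ i ∈ Finset.Ico s (s + 2 ^ m), α i) ^ 2 / 2 ^ m -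
      (∑ i ∈ Finset.Ico s (s + 2 ^ m), β i) ^ 2 / 2 ^ m) := by
  have hsum : ∀ γ : ℕ → ℝ, (∀ i, |γ i| ≤ 1) → ∀ m s : ℕ,
      |∑ i ∈ Finset.Ico s (s + 2 ^ m), γ i| ≤ 2 ^ m := by
    intro γ hγ m s
    refine (Finset.abs_sum_le_sum_abs _ _).trans ((Finset.sum_le_sum fun i _ => hγ i).trans ?_)
    simp
  induction m with
  | zero =>
    intro s _
    have h1 : (∑ i ∈ Finset.Ico s (s + 2 ^ 0), α i) ^ 2 ≤ 1 := by
      have := hsum α hα 0 s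
      rw [pow_zero] at this ⊢
      exact (sq_le_one_iff_abs_le_one _).2 this
    have h2 : (∑ i ∈ Finset.Ico s (s + 2 ^ 0), β i) ^ 2 ≤ 1 := by
      have := hsum β hβ 0 s
      rw [pow_zero] at this ⊢
      exact (sq_le_one_iff_abs_le_one _).2 this
    have h3 : gtSum n 0 s (fun i j => α i * β j) = 0 := by simp [gtSum, gtWeight]
    rw [h3, abs_zero, Nat.cast_zero, zero_mul, zero_div, zero_add, pow_zero, div_one, div_one]
    exact mul_nonneg (by positivity) (by linarith)
  | succ m ih =>
    intro s hs
    have hpow : 2 ^ (m + 1) = 2 ^ m + 2 ^ m := by ring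
    have hpos : 0 < 2 ^ m := Nat.two_pow_pos m
    rw [gtSum_succ hs]
    have hsplit : ∀ γ : ℕ → ℝ, ∑ i ∈ Finset.Ico s (s + 2 ^ (m + 1)), γ i =
        ∑ i ∈ Finset.Ico s (s + 2 ^ m), γ i +
          ∑ i ∈ Finset.Ico (s + 2 ^ m) (s + 2 ^ m + 2 ^ m), γ i := by
      intro γ
      rw [hpow, ← add_assoc]
      exact (Finset.sum_Ico_consecutive γ (by omega) (by omega)).symm
    rw [hsplit α, hsplit β]
    simp only [← Finset.sum_mul_sum]
    have i1 := ih s (by omega)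
    have i2 := ih (s + 2 ^ m) (by omega)
    have a1 := hsum α hα m s
    have b1 := hsum β hβ m s
    generalize ∑ i ∈ Finset.Ico s (s + 2 ^ m), α i = a at *
    generalize ∑ i ∈ Finset.Ico s (s + 2 ^ m), β i = b at *
    generalize ∑ i ∈ Finset.Ico (s + 2 ^ m) (s + 2 ^ m + 2 ^ m), α i = a' at *
    generalize ∑ i ∈ Finset.Ico (s + 2 ^ m) (s + 2 ^ m + 2 ^ m), β i = b' at *
    generalize gtSum n m s (fun i j => α i * β j) = u at *
    generalize gtSum n m (s + 2 ^ m) (fun i j => α i * β j) = v at *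
    have hK : (0 : ℝ) < 2 ^ m := by positivity
    rw [pow_succ]
    push_cast
    generalize (2 : ℝ) ^ m = K at *
    have young : ∀ d : ℝ, |d| ≤ c * d ^ 2 / K + K / (4 * c) := by
      intro d
      have h : 0 ≤ (2 * c * |d| - K) ^ 2 / (4 * c * K) := by positivity
      have h' : (2 * c * |d| - K) ^ 2 / (4 * c * K) = c * d ^ 2 / K + K / (4 * c) - |d| := by
        rw [← sq_abs d]
        field_simp
        ring
      linarith
    have hcross : |1 / K * (a * b' - a' * b)| ≤ |b' - b| + |a' - a| := by
      have h1 : a * b' - a' * b = a * (b' - b) - b * (a' - a) := by ring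
      rw [abs_mul, abs_of_pos (by positivity : 0 < 1 / K), one_div_mul_eq_div, div_le_iff₀ hK, h1]
      calc |a * (b' - b) - b * (a' - a)| ≤ |a| * |b' - b| + |b| * |a' - a| := by
            rw [← abs_mul, ← abs_mul]
            exact abs_sub _ _
        _ ≤ K * |b' - b| + K * |a' - a| := by gcongr
        _ = _ := by ring
    have y1 := young (a' - a)
    have y2 := young (b' - b)
    have t1 := abs_add_le (u + v) (1 / K * (a * b' - a' * b))
    have t2 := abs_add_le u v
    have e : (m + 1) * (K * 2) / (4 * c) + 2 * c * (2 * (K * 2) - (a + a') ^ 2 / (K * 2) -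
        (b + b') ^ 2 / (K * 2)) = (m * K / (4 * c) + 2 * c * (2 * K - a ^ 2 / K - b ^ 2 / K)) +
        (m * K / (4 * c) + 2 * c * (2 * K - a' ^ 2 / K - b' ^ 2 / K)) +
        (c * (a' - a) ^ 2 / K + K / (4 * c)) + (c * (b' - b) ^ 2 / K + K / (4 * c)) := by
      field_simp
      ring
    rw [e]
    linarith

/-- A deterministic protocol of low cost has small correlation with any weights that are small on
all rectangles. -/
theorem Protocol.sum_run_le {X Y : Type} {n : ℕ} (w : ℕ → ℕ → ℝ) {d : ℝ} (a : ℕ → X) (b : ℕ → Y)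
    (hw : ∀ α β : ℕ → ℝ, (∀ i, |α i| ≤ 1) → (∀ i, |β i| ≤ 1) →
      |∑ i ∈ Finset.range n, ∑ j ∈ Finset.range n, w i j * (α i * β j)| ≤ d) (p : Protocol X Y) :
    ∀ α β : ℕ → ℝ, (∀ i, |α i| ≤ 1) → (∀ i, |β i| ≤ 1) →
      ∑ i ∈ Finset.range n, ∑ j ∈ Finset.range n,
        w i j * (α i * β j) * ((p.run (a i) (b j) : ℤˣ) : ℤ) ≤ 2 ^ p.cost * d := by
  have hd : 0 ≤ d := (abs_nonneg _).trans (hw 0 0 (by simp) (by simp))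
  have hpow : ∀ c₀ c₁ : ℕ, 2 ^ c₁ * d + 2 ^ c₀ * d ≤ 2 ^ (max c₀ c₁ + 1) * d := by
    intro c₀ c₁
    have h1 : (2 : ℝ) ^ c₁ ≤ 2 ^ max c₀ c₁ := pow_le_pow_right₀ (by norm_num) (le_max_right _ _)
    have h0 : (2 : ℝ) ^ c₀ ≤ 2 ^ max c₀ c₁ := pow_le_pow_right₀ (by norm_num) (le_max_left _ _)
    rw [pow_succ, ← add_mul]
    exact mul_le_mul_of_nonneg_right (by linarith) hd
  induction p with
  | output v =>
    intro α β hα hβ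
    simp only [Protocol.run, Protocol.cost, pow_zero, one_mul, ← Finset.sum_mul]
    have h := hw α β hα hβ
    rcases Int.units_eq_one_or v with rfl | rfl
    · simpa using (le_abs_self _).trans h
    · simpa using (neg_le_abs _).trans h
  | alice f p₀ p₁ ih₀ ih₁ =>
    intro α β hα hβ
    have habs : ∀ (v : Bool) i, |if f (a i) = v then α i else 0| ≤ 1 := fun v i => by
      split_ifs
      · exact hα i
      · simp
    refine le_trans (le_of_eq ?_) ((add_le_add (ih₁ _ β (habs true) hβ)
      (ih₀ _ β (habs false) hβ)).trans (hpow _ _))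
    simp only [← Finset.sum_add_distrib]
    refine Finset.sum_congr rfl fun i _ => Finset.sum_congr rfl fun j _ => ?_
    cases h : f (a i) <;> simp [Protocol.run, h]
  | bob g p₀ p₁ ih₀ ih₁ =>
    intro α β hα hβ
    have habs : ∀ (v : Bool) i, |if g (b i) = v then β i else 0| ≤ 1 := fun v i => by
      split_ifs
      · exact hβ i
      · simp
    refine le_trans (le_of_eq ?_) ((add_le_add (ih₁ α _ hα (habs true))
      (ih₀ α _ hα (habs false))).trans (hpow _ _))
    simp only [← Finset.sum_add_distrib]
    refine Finset.sum_congr rfl fun i _ => Finset.sum_congr rfl fun j _ => ?_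
    cases h : g (b j) <;> simp [Protocol.run, h]

open Classical in
/-- If each of finitely many events has probability at least `2 / 3`, then some outcome lies in
events that together have at least `3 / 5` of the total weight. -/
theorem exists_mem_support_weight_le {Ω I : Type} (μ : PMF Ω) (S : Finset I) (w : I → ℝ)
    (hw : ∀ i ∈ S, 0 ≤ w i) (E : I → Set Ω) (hE : ∀ i ∈ S, (2 / 3 : ℝ≥0∞) ≤ μ.toOuterMeasure (E i)) :
    ∃ p ∈ μ.support, 3 / 5 * ∑ i ∈ S, w i ≤ ∑ i ∈ S, if p ∈ E i then w i else 0 := by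
  by_contra! hcon
  obtain ⟨p₀, hp₀⟩ := μ.support_nonempty
  set T := ∑ i ∈ S, w i with hT
  have hTpos : 0 < T := by
    have h1 := hcon p₀ hp₀
    have h2 : 0 ≤ ∑ i ∈ S, if p₀ ∈ E i then w i else 0 :=
      Finset.sum_nonneg fun i hi => by split_ifs <;> simp [hw i hi]
    linarith
  have hle : ∀ p, ∑ i ∈ S, ENNReal.ofReal (w i) * (E i).indicator μ p ≤
      ENNReal.ofReal (3 / 5 * T) * μ p := by
    intro p
    by_cases hp : p ∈ μ.support
    · have h1 : ∑ i ∈ S, ENNReal.ofReal (w i) * (E i).indicator μ p =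
          ENNReal.ofReal (∑ i ∈ S, if p ∈ E i then w i else 0) * μ p := by
        rw [ENNReal.ofReal_sum_of_nonneg fun i hi => by split_ifs <;> simp [hw i hi],
          Finset.sum_mul]
        refine Finset.sum_congr rfl fun i _ => ?_
        by_cases hi : p ∈ E i <;> simp [hi]
      rw [h1]
      gcongr
      exact (hcon p hp).le
    · have : μ p = 0 := by simpa [PMF.mem_support_iff] using hp
      have h0 : ∀ i, (E i).indicator μ p = 0 := fun i => by
        by_cases hi : p ∈ E i <;> simp [hi, this]
      simp [h0]
  have hsum : ENNReal.ofReal T * (2 / 3) ≤ ENNReal.ofReal (3 / 5 * T) := by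
    calc ENNReal.ofReal T * (2 / 3) = ∑ i ∈ S, ENNReal.ofReal (w i) * (2 / 3) := by
          rw [hT, ENNReal.ofReal_sum_of_nonneg hw, Finset.sum_mul]
      _ ≤ ∑ i ∈ S, ENNReal.ofReal (w i) * μ.toOuterMeasure (E i) := by
          refine Finset.sum_le_sum fun i hi => ?_
          gcongr
          exact hE i hi
      _ = ∑' p, ∑ i ∈ S, ENNReal.ofReal (w i) * (E i).indicator μ p := by
          rw [Summable.tsum_finsetSum fun i _ => ENNReal.summable]
          refine Finset.sum_congr rfl fun i _ => ?_
          rw [PMF.toOuterMeasure_apply, ENNReal.tsum_mul_left]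
      _ ≤ ∑' p, ENNReal.ofReal (3 / 5 * T) * μ p := ENNReal.tsum_le_tsum hle
      _ = ENNReal.ofReal (3 / 5 * T) := by rw [ENNReal.tsum_mul_left, PMF.tsum_coe, mul_one]
  have h23 : (2 / 3 : ℝ≥0∞) = ENNReal.ofReal (2 / 3) := by
    rw [ENNReal.ofReal_div_of_pos (by norm_num)]
    simp
  rw [h23, ← ENNReal.ofReal_mul hTpos.le, ENNReal.ofReal_le_ofReal_iff (by positivity)] at hsum
  linarith

/-- A relation whose sign matrix has a randomized protocol of cost `c` contains no long chain: a
fixed protocol that is correct on most of the pairs, counted with `gtWeight`, would cut the chain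
into `2 ^ c` rectangles, on which the weights almost cancel. -/
theorem exists_chain_bound (c : ℕ) : ∃ k : ℕ, ∀ {X Y : Type} (P : X → Y → Prop)
    (μ : PMF (Protocol X Y)), ComputesWithCost (signMatrix P) μ c → ¬ Chain P .univ .univ k := by
  set r : ℕ := 3 * 2 ^ c with hr
  set m : ℕ := 16 * r ^ 2 with hm
  refine ⟨2 ^ m, fun {X Y} P μ hμ hch => ?_⟩
  set n := 2 ^ m with hn
  have hn0 : 0 < n := by positivity
  obtain ⟨a₀, b₀, -, -, hab₀⟩ := hch
  set a : ℕ → X := fun i => if h : i < n then a₀ ⟨i, h⟩ else a₀ ⟨0, hn0⟩ with ha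
  set b : ℕ → Y := fun i => if h : i < n then b₀ ⟨i, h⟩ else b₀ ⟨0, hn0⟩ with hb
  have hab : ∀ i j, i < n → j < n → i < j → P (a i) (b j) ∧ ¬ P (a j) (b i) := by
    intro i j hi hj hij
    simp only [ha, hb, hi, hj, dif_pos]
    exact hab₀ ⟨i, hi⟩ ⟨j, hj⟩ hij
  set σ : ℕ → ℕ → ℝ := fun i j => if i < j then 1 else -1 with hσ
  have hrpos : (0 : ℝ) < r := by
    rw [hr]
    positivity
  have hwσ : ∀ i j, 0 ≤ gtWeight m 0 i j * σ i j := by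
    intro i j
    rcases lt_trichotomy i j with h | rfl | h
    · simpa [hσ, h] using gtWeight_nonneg m h
    · have := gtWeight_antisymm m 0 i i
      have : gtWeight m 0 i i = 0 := by linarith
      simp [this]
    · have h1 := gtWeight_antisymm m 0 j i
      have h2 := gtWeight_nonneg m (s := 0) h
      simp only [hσ, not_lt.2 h.le, if_false]
      linarith
  obtain ⟨p, hp, hle⟩ := exists_mem_support_weight_le μ (Finset.range n ×ˢ Finset.range n)
    (fun z => gtWeight m 0 z.1 z.2 * σ z.1 z.2) (fun z _ => hwσ _ _)
    (fun z => {p | p.run (a z.1) (b z.2) = signMatrix P (a z.1) (b z.2)})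
    fun z _ => hμ.2 _ _
  have htotal : ∑ z ∈ Finset.range n ×ˢ Finset.range n, gtWeight m 0 z.1 z.2 * σ z.1 z.2 =
      m * 2 ^ m := by
    rw [Finset.sum_product, ← gtSum_sign (n := n) m 0 (by omega)]
    rfl
  have hcorr : ∀ z ∈ Finset.range n ×ˢ Finset.range n,
      2 * (if p.run (a z.1) (b z.2) = signMatrix P (a z.1) (b z.2) then
        gtWeight m 0 z.1 z.2 * σ z.1 z.2 else 0) - gtWeight m 0 z.1 z.2 * σ z.1 z.2 ≤
      gtWeight m 0 z.1 z.2 * (1 * 1) * ((p.run (a z.1) (b z.2) : ℤˣ) : ℤ) := by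
    rintro ⟨i, j⟩ hz
    simp only [Finset.mem_product, Finset.mem_range] at hz
    have h0 := hwσ i j
    rcases lt_trichotomy i j with h | rfl | h
    · have hs : signMatrix P (a i) (b j) = 1 := if_pos (hab i j hz.1 hz.2 h).1
      simp only [hs, hσ, h, if_true, mul_one] at h0 ⊢
      rcases Int.units_eq_one_or (p.run (a i) (b j)) with h1 | h1 <;> rw [h1] <;> simp
      · linarith
    · have := gtWeight_antisymm m 0 i i
      have : gtWeight m 0 i i = 0 := by linarith
      simp [this]
    · have hs : signMatrix P (a i) (b j) = -1 := if_neg (hab j i hz.2 hz.1 h).2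
      simp only [hs, hσ, not_lt.2 h.le, if_false, mul_one] at h0 ⊢
      rcases Int.units_eq_one_or (p.run (a i) (b j)) with h1 | h1 <;> rw [h1] <;> simp
      · linarith
  have hlower : 1 / 5 * (m * 2 ^ m : ℝ) ≤ ∑ z ∈ Finset.range n ×ˢ Finset.range n,
      gtWeight m 0 z.1 z.2 * (1 * 1) * ((p.run (a z.1) (b z.2) : ℤˣ) : ℤ) := by
    refine le_trans ?_ (Finset.sum_le_sum hcorr)
    rw [Finset.sum_sub_distrib, ← Finset.mul_sum, htotal]
    rw [htotal] at hle
    simp only [Set.mem_ofPred_eq] at hle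
    have : ∀ x : ℝ, 3 / 5 * (m * 2 ^ m : ℝ) ≤ x → 1 / 5 * (m * 2 ^ m : ℝ) ≤ 2 * x - m * 2 ^ m := by
      intro x hx
      linarith
    exact this _ (by convert hle)
  have hupper := Protocol.sum_run_le (gtWeight m 0) (n := n) (d := 8 * r * 2 ^ m) a b (by
    intro α β hα hβ
    refine (abs_gtSum_le (n := n) hrpos hα hβ m 0 (by omega)).trans ?_
    have h1 : 0 ≤ (∑ i ∈ Finset.Ico 0 (0 + 2 ^ m), α i) ^ 2 / 2 ^ m := by positivity
    have h2 : 0 ≤ (∑ i ∈ Finset.Ico 0 (0 + 2 ^ m), β i) ^ 2 / 2 ^ m := by positivity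
    have h3 : (m * 2 ^ m / (4 * r) : ℝ) = 4 * r * 2 ^ m := by
      rw [hm]
      push_cast
      field_simp
      ring
    rw [h3]
    nlinarith) p 1 1 (by simp) (by simp)
  rw [Finset.sum_product] at hlower
  have hcost : (2 : ℝ) ^ p.cost ≤ 2 ^ c := pow_le_pow_right₀ (by norm_num) (hμ.1 p hp)
  have hfinal : 1 / 5 * (m * 2 ^ m : ℝ) ≤ 2 ^ c * (8 * r * 2 ^ m) :=
    hlower.trans (hupper.trans (by gcongr))
  have hrc : (r : ℝ) = 3 * 2 ^ c := by
    rw [hr]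
    push_cast
    ring
  have hmr : (m : ℝ) = 16 * r ^ 2 := by
    rw [hm]
    push_cast
    ring
  have h2c : (2 : ℝ) ^ c = r / 3 := by linarith
  rw [hmr, h2c] at hfinal
  have hpos : (0 : ℝ) < r ^ 2 * 2 ^ m := by positivity
  nlinarith

/-! ### Chain-index and half-graphs of the adjacency relation -/

theorem hasChain_zero {V : Type} (G : SimpleGraph V) : HasChain G 0 :=
  ⟨Fin.elim0, Fin.elim0, fun i => i.elim0, fun i => i.elim0, fun i => i.elim0, fun i => i.elim0⟩

theorem bddAbove_hasChain {V : Type} [Finite V] (G : SimpleGraph V) :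
    BddAbove {k | HasChain G k} := by
  refine ⟨Nat.card V, ?_⟩
  rintro k ⟨a, b, ha, -⟩
  simpa using Nat.card_le_card_of_injective a ha

theorem not_hasChain_of_chainIndex_le {V : Type} [Finite V] {G : SimpleGraph V} {k : ℕ}
    (h : chainIndex G ≤ k) : ¬ HasChain G (k + 1) := fun hk =>
  absurd (le_csSup (bddAbove_hasChain G) hk) (by unfold chainIndex at h; omega)

theorem hasChain_chainIndex {V : Type} [Finite V] (G : SimpleGraph V) :
    HasChain G (chainIndex G) :=
  Nat.sSup_mem (s := {k | HasChain G k}) ⟨0, hasChain_zero G⟩ (bddAbove_hasChain G)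

theorem HasChain.chain {V : Type} {G : SimpleGraph V} {k : ℕ} (h : HasChain G k) :
    Chain G.Adj .univ .univ k := by
  obtain ⟨a, b, -, -, -, hab⟩ := h
  exact ⟨a, b, fun _ => trivial, fun _ => trivial,
    fun i j hij => ⟨(hab i j hij).1, fun h => (hab i j hij).2 h.symm⟩⟩

/-- Every second pair of a chain between disjoint sets is kept, which makes the vertices
distinct. -/
theorem hasChain_of_chain {V : Type} {G : SimpleGraph V} {A B : Set V} (hAB : Disjoint A B) {k : ℕ}
    (h : Chain G.Adj A B (2 * k)) : HasChain G k := by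
  obtain ⟨a, b, ha, hb, hab⟩ := h
  refine ⟨fun i => a ⟨2 * i, by omega⟩, fun i => b ⟨2 * i, by omega⟩, ?_, ?_, ?_, ?_⟩
  · refine Function.Injective.of_lt_imp_ne fun i j hij heq => ?_
    have h1 := (hab ⟨2 * i, by omega⟩ ⟨2 * i + 1, by omega⟩ (by simp [Fin.lt_def])).1
    have h2 := (hab ⟨2 * i + 1, by omega⟩ ⟨2 * j, by omega⟩
      (by simp only [Fin.lt_def] at hij ⊢; omega)).2
    exact h2 (heq ▸ h1)
  · refine Function.Injective.of_lt_imp_ne fun i j hij heq => ?_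
    have h1 := (hab ⟨2 * i, by omega⟩ ⟨2 * i + 1, by omega⟩ (by simp [Fin.lt_def])).2
    have h2 := (hab ⟨2 * i + 1, by omega⟩ ⟨2 * j, by omega⟩
      (by simp only [Fin.lt_def] at hij ⊢; omega)).1
    exact h1 (heq ▸ h2)
  · exact fun i j heq => Set.disjoint_left.1 hAB (ha _) ((congrArg (· ∈ B) heq).mpr (hb _))
  · intro i j hij
    have := hab ⟨2 * i, by omega⟩ ⟨2 * j, by omega⟩ (by simp only [Fin.lt_def] at hij ⊢; omega)
    exact ⟨this.1, fun h => this.2 h.symm⟩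

/-- A relation that agrees with a graph off the diagonal may use diagonal entries in its chains.
By the symmetry of the graph, this cannot happen both in the first and in the second half of a
chain. -/
theorem hasChain_of_chain_off_diagonal {V : Type} {G : SimpleGraph V} {P : V → V → Prop}
    (hP : ∀ x y, x ≠ y → (P x y ↔ G.Adj x y)) {k : ℕ}
    (h : Chain P .univ .univ (2 * k + 2 * k)) : HasChain G k := by
  obtain ⟨a, b, -, -, hab⟩ := h
  have half : ∀ e : Fin (2 * k) → Fin (2 * k + 2 * k), StrictMono e →
      (∀ i j, a (e i) ≠ b (e j)) → HasChain G k := by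
    intro e he hne
    refine hasChain_of_chain (A := Set.range (a ∘ e)) (B := Set.range (b ∘ e)) ?_
      ⟨a ∘ e, b ∘ e, fun i => ⟨i, rfl⟩, fun i => ⟨i, rfl⟩, fun i j hij => ?_⟩
    · rw [Set.disjoint_left]
      rintro _ ⟨i, rfl⟩ ⟨j, hj⟩
      exact hne i j hj.symm
    · have := hab _ _ (he hij)
      rwa [hP _ _ (hne i j), hP _ _ (hne j i)] at this
  by_contra hG
  have h1 : ∃ i j, a (Fin.castAdd (2 * k) i) = b (Fin.castAdd (2 * k) j) := by
    by_contra! hne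
    exact hG (half _ (Fin.strictMono_castAdd _) hne)
  have h2 : ∃ i j, a (Fin.natAdd (2 * k) i) = b (Fin.natAdd (2 * k) j) := by
    by_contra! hne
    exact hG (half _ (Fin.strictMono_natAdd _) hne)
  obtain ⟨i, j, hij⟩ := h1
  obtain ⟨i', j', hij'⟩ := h2
  have p1 := (hab (Fin.castAdd (2 * k) i) (Fin.natAdd (2 * k) j')
    (by simp only [Fin.lt_def, Fin.val_castAdd, Fin.val_natAdd]; omega)).1
  have p2 := (hab (Fin.castAdd (2 * k) j) (Fin.natAdd (2 * k) i')
    (by simp only [Fin.lt_def, Fin.val_castAdd, Fin.val_natAdd]; omega)).2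
  rw [hij'] at p2
  rw [hij] at p1
  by_cases heq : b (Fin.castAdd (2 * k) j) = b (Fin.natAdd (2 * k) j')
  · rw [heq] at p1 p2
    exact p2 p1
  · exact p2 ((hP _ _ (Ne.symm heq)).2 ((hP _ _ heq).1 p1).symm)

theorem BipartiteGraph.hasChain_of_chain {X Y : Type} {B : BipartiteGraph X Y} {k : ℕ}
    (h : Chain B.Adj .univ .univ (2 * k)) : HasChain B.toSimpleGraph k := by
  obtain ⟨a, b, -, -, hab⟩ := h
  refine GraphComm.hasChain_of_chain (A := Set.range Sum.inl) (B := Set.range Sum.inr) ?_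
    ⟨Sum.inl ∘ a, Sum.inr ∘ b, fun i => ⟨_, rfl⟩, fun i => ⟨_, rfl⟩, fun i j hij => hab i j hij⟩
  rw [Set.disjoint_left]
  rintro _ ⟨x, rfl⟩ ⟨y, hy⟩
  cases hy

/-- Except for its ends, each side of a chain in a bipartite graph lies on one side of the
graph. -/
theorem BipartiteGraph.chain_of_hasChain {X Y : Type} {B : BipartiteGraph X Y} {k : ℕ}
    (h : HasChain B.toSimpleGraph (k + 2)) : Chain B.Adj .univ .univ k := by
  obtain ⟨a, b, -, -, -, hab⟩ := h
  have hb : ∀ i : Fin k, B.toSimpleGraph.Adj (a 0) (b i.castSucc.succ) := fun i =>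
    (hab _ _ (Fin.succ_pos _)).1
  have hl : B.toSimpleGraph.Adj (a 0) (b (Fin.last _)) := (hab _ _ (Fin.last_pos)).1
  have ha : ∀ i : Fin k, B.toSimpleGraph.Adj (a i.castSucc.succ) (b (Fin.last _)) := fun i =>
    (hab _ _ (by simp [Fin.lt_def])).1
  have hlt : ∀ i j : Fin k, i < j → i.castSucc.succ < j.castSucc.succ := fun i j hij => by
    simpa using hij
  rcases h0 : a 0 with x₀ | y₀
  · rw [h0] at hb hl
    have hb' : ∀ i : Fin k, ∃ y, b i.castSucc.succ = Sum.inr y := fun i => by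
      have := hb i
      rcases h : b i.castSucc.succ with x | y
      · rw [h] at this
        exact this.elim
      · exact ⟨y, rfl⟩
    obtain ⟨y₁, hy₁⟩ : ∃ y, b (Fin.last _) = Sum.inr y := by
      rcases h : b (Fin.last _) with x | y
      · rw [h] at hl
        exact hl.elim
      · exact ⟨y, rfl⟩
    have ha' : ∀ i : Fin k, ∃ x, a i.castSucc.succ = Sum.inl x := fun i => by
      have := ha i
      rw [hy₁] at this
      rcases h : a i.castSucc.succ with x | y
      · exact ⟨x, rfl⟩
      · rw [h] at this
        exact this.elim
    choose x hx using ha'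
    choose y hy using hb'
    refine ⟨x, y, fun _ => trivial, fun _ => trivial, fun i j hij => ?_⟩
    have := hab _ _ (hlt i j hij)
    rwa [hx, hy, hx, hy] at this
  · rw [h0] at hb hl
    have hb' : ∀ i : Fin k, ∃ x, b i.castSucc.succ = Sum.inl x := fun i => by
      have := hb i
      rcases h : b i.castSucc.succ with x | y
      · exact ⟨x, rfl⟩
      · rw [h] at this
        exact this.elim
    obtain ⟨x₁, hx₁⟩ : ∃ x, b (Fin.last _) = Sum.inl x := by
      rcases h : b (Fin.last _) with x | y
      · exact ⟨x, rfl⟩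
      · rw [h] at hl
        exact hl.elim
    have ha' : ∀ i : Fin k, ∃ y, a i.castSucc.succ = Sum.inr y := fun i => by
      have := ha i
      rw [hx₁] at this
      rcases h : a i.castSucc.succ with x | y
      · rw [h] at this
        exact this.elim
      · exact ⟨y, rfl⟩
    choose y hy using ha'
    choose x hx using hb'
    refine Chain.of_reverse x y (fun _ => trivial) (fun _ => trivial) fun i j hij => ?_
    have := hab _ _ (hlt i j hij)
    rwa [hx, hy, hx, hy] at this

/-! ### Stable unit disk graphs and graphs of sign-rank at most three -/

theorem EqDecides.and_ne {V ι : Type} [Finite V] {P : V → V → Prop}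
    (h : EqDecides ι .univ .univ P) : EqDecides (Option ι) .univ .univ fun x y => x ≠ y ∧ P x y := by
  obtain ⟨n, ⟨e⟩⟩ := Finite.exists_equiv_fin V
  obtain ⟨f, g, F, hF⟩ := h
  refine ⟨fun x i => i.elim (e x : ℕ) (f x), fun y i => i.elim (e y : ℕ) (g y),
    fun x U => none ∉ U ∧ F x (some ⁻¹' U), fun x _ y _ => ?_⟩
  refine (and_congr_right' (hF x trivial y trivial)).trans ?_
  simp [Set.preimage, Fin.val_inj, e.injective.eq_iff]

/-- The two players first compare the sides on which their vertices lie. -/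
theorem EqDecides.toSimpleGraph {X Y ι : Type} {B : BipartiteGraph X Y}
    (h : EqDecides ι .univ .univ B.Adj) :
    EqDecides (Option (ι ⊕ (ι ⊕ Set ι))) .univ .univ B.toSimpleGraph.Adj := by
  obtain ⟨f', g', F', h'⟩ := h.swap
  obtain ⟨f, g, F, h⟩ := h
  refine ⟨Sum.elim (fun x i => i.elim 0 (Sum.elim (f x) 0))
      fun y i => i.elim 1 (Sum.elim 0 (f' y)),
    Sum.elim (fun x i => i.elim 1 (Sum.elim 0 (g' x))) fun y i => i.elim 0 (Sum.elim (g y) 0),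
    fun w U => none ∈ U ∧ w.elim (fun x => F x {i | some (Sum.inl i) ∈ U})
      fun y => F' y {i | some (Sum.inr i) ∈ U}, ?_⟩
  rintro (x | y) - (x' | y') -
  · simp [BipartiteGraph.toSimpleGraph]
  · simpa [BipartiteGraph.toSimpleGraph] using h x trivial y' trivial
  · simpa [BipartiteGraph.toSimpleGraph] using h' y trivial x' trivial
  · simp [BipartiteGraph.toSimpleGraph]

theorem sgn_eq_signMatrix_iff {X Y : Type} {P : X → Y → Prop} {t : ℝ} {x : X} {y : Y} :
    sgn t = signMatrix P x y ↔ (0 ≤ t ↔ P x y) := by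
  unfold sgn signMatrix
  split_ifs with h1 h2 h2 <;> simp [h1, h2]

theorem exists_sgn_eq_signMatrix {X Y : Type} (P : X → Y → Prop) :
    ∃ R : Matrix X Y ℝ, ∀ x y, sgn (R x y) = signMatrix P x y := by
  classical
  refine ⟨fun x y => if P x y then 1 else -1, fun x y => sgn_eq_signMatrix_iff.2 ?_⟩
  by_cases h : P x y <;> simp [h]

theorem exists_rank_le_of_signRank_le {V : Type} [Fintype V] {G : SimpleGraph V} {d : ℕ}
    (h : signRank G ≤ d) :
    ∃ R : Matrix V V ℝ, R.rank ≤ d ∧ ∀ x y, x ≠ y → (0 ≤ R x y ↔ G.Adj x y) := by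
  obtain ⟨R₀, hR₀⟩ := exists_sgn_eq_signMatrix G.Adj
  obtain ⟨R, hR, hsgn⟩ := Nat.sInf_mem
    (s := {d | ∃ R : Matrix V V ℝ, R.rank = d ∧ ∀ x y, x ≠ y → sgn (R x y) = adjSign G x y})
    ⟨_, R₀, rfl, fun x y _ => hR₀ x y⟩
  exact ⟨R, hR.trans_le h, fun x y hxy => sgn_eq_signMatrix_iff.1 (hsgn x y hxy)⟩

theorem BipartiteGraph.exists_rank_le_of_signRank_le {X Y : Type} [Fintype X] [Fintype Y]
    {B : BipartiteGraph X Y} {d : ℕ} (h : B.signRank ≤ d) :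
    ∃ R : Matrix X Y ℝ, R.rank ≤ d ∧ ∀ x y, (0 ≤ R x y ↔ B.Adj x y) := by
  obtain ⟨R₀, hR₀⟩ := exists_sgn_eq_signMatrix B.Adj
  obtain ⟨R, hR, hsgn⟩ := Nat.sInf_mem
    (s := {d | ∃ R : Matrix X Y ℝ, R.rank = d ∧ ∀ x y, sgn (R x y) = B.adjSign x y})
    ⟨_, R₀, rfl, hR₀⟩
  exact ⟨R, hR.trans_le h, fun x y => sgn_eq_signMatrix_iff.1 (hsgn x y)⟩

namespace GraphClass

theorem Stable.exists_eqDecides {𝒢 : GraphClass} (h𝒢 : 𝒢.IsUnitDisk ∨ 𝒢.SignRankAtMost 3)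
    (hs : 𝒢.Stable) :
    ∃ ι : Type, Finite ι ∧ ∀ N, ∀ G ∈ 𝒢.members N, EqDecides ι .univ .univ G.Adj := by
  obtain ⟨k, hk⟩ := hs
  rcases h𝒢 with h𝒢 | h𝒢
  · obtain ⟨ι, hι, h⟩ := eqDecides_of_isUnitDisk (2 * (k + 1))
    exact ⟨ι, hι, fun N G hG => h G (h𝒢 N G hG) fun A B hAB hch =>
      not_hasChain_of_chainIndex_le (hk N G hG) (hasChain_of_chain hAB hch)⟩
  · obtain ⟨ι, hι, h⟩ := eqDecides_of_rank_le_three (2 * (k + 1) + 2 * (k + 1))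
    refine ⟨Option ι, inferInstance, fun N G hG => ?_⟩
    obtain ⟨R, hR, hRG⟩ := exists_rank_le_of_signRank_le (h𝒢 N G hG)
    refine (h R hR fun hch => not_hasChain_of_chainIndex_le (hk N G hG)
      (hasChain_of_chain_off_diagonal hRG hch)).and_ne.congr fun x _ y _ => ?_
    exact ⟨fun hxy => ⟨hxy.ne, (hRG x y hxy.ne).2 hxy⟩, fun hxy => (hRG x y hxy.1).1 hxy.2⟩

theorem ConstantCost.stable {𝒢 : GraphClass} (h : 𝒢.ConstantCost) : 𝒢.Stable := by
  obtain ⟨c, hc⟩ := h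
  obtain ⟨k, hk⟩ := exists_chain_bound c
  refine ⟨k, fun N G hG => ?_⟩
  have hle : randCC (signMatrix G.Adj) ≤ c := by
    have := (le_iSup₂ (f := fun (G : SimpleGraph (Fin N)) (_ : G ∈ 𝒢.members N) =>
      (randCC (adjSign G) : ℕ∞)) G hG).trans (hc N)
    exact_mod_cast this
  obtain ⟨μ, hμ⟩ := exists_computesWithCost_of_randCC_le hle
  by_contra hlt
  exact hk _ μ hμ ((hasChain_chainIndex G).chain.of_le (not_le.1 hlt).le)

end GraphClass

namespace BipartiteGraphClass

theorem Stable.exists_eqDecides {𝒢 : BipartiteGraphClass}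
    (h𝒢 : 𝒢.IsUnitDisk ∨ 𝒢.SignRankAtMost 3) (hs : 𝒢.Stable) :
    ∃ ι : Type, Finite ι ∧ ∀ m n, ∀ B ∈ 𝒢.members m n, EqDecides ι .univ .univ B.Adj := by
  obtain ⟨k, hk⟩ := hs
  rcases h𝒢 with h𝒢 | h𝒢
  · obtain ⟨ι, hι, h⟩ := eqDecides_of_isUnitDisk (2 * (k + 1))
    refine ⟨ι, hι, fun m n B hB => ?_⟩
    exact (h B.toSimpleGraph (h𝒢 m n B hB) fun A A' hAA' hch =>
      not_hasChain_of_chainIndex_le (hk m n B hB) (hasChain_of_chain hAA' hch)).comap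
      Sum.inl Sum.inr
  · obtain ⟨ι, hι, h⟩ := eqDecides_of_rank_le_three (2 * (k + 1))
    refine ⟨ι, hι, fun m n B hB => ?_⟩
    obtain ⟨R, hR, hRB⟩ := B.exists_rank_le_of_signRank_le (h𝒢 m n B hB)
    have hP : (fun x y => 0 ≤ R x y) = B.Adj := funext₂ fun x y => propext (hRB x y)
    have hB' := h R hR
    rw [hP] at hB'
    exact hB' fun hch => not_hasChain_of_chainIndex_le (hk m n B hB) (B.hasChain_of_chain hch)

theorem ConstantCost.stable {𝒢 : BipartiteGraphClass} (h : 𝒢.ConstantCost) : 𝒢.Stable := by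
  obtain ⟨c, hc⟩ := h
  obtain ⟨k, hk⟩ := exists_chain_bound c
  refine ⟨k + 2, fun m n B hB => ?_⟩
  have hle : randCC (signMatrix B.Adj) ≤ c := by
    have : (randCC B.adjSign : ℕ∞) ≤ c := by
      refine le_trans ?_ (hc (m + n))
      unfold commCost
      refine le_iSup_of_le m (le_iSup_of_le n (le_iSup_of_le rfl ?_))
      exact le_iSup₂ (f := fun (B : BipartiteGraph (Fin m) (Fin n)) (_ : B ∈ 𝒢.members m n) =>
        (randCC B.adjSign : ℕ∞)) B hB
    exact_mod_cast this
  obtain ⟨μ, hμ⟩ := exists_computesWithCost_of_randCC_le hle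
  by_contra hlt
  have hch : HasChain B.toSimpleGraph (chainIndex B.toSimpleGraph - 2 + 2) := by
    rw [Nat.sub_add_cancel (by omega)]
    exact hasChain_chainIndex _
  exact hk _ μ hμ ((B.chain_of_hasChain hch).of_le (by omega))

end BipartiteGraphClass

end GraphComm

theorem theorem1p2 :
    (∀ 𝒢 : GraphComm.GraphClass, 𝒢.IsUnitDisk ∨ 𝒢.SignRankAtMost 3 →
      (𝒢.ConstantCost ↔ 𝒢.Stable) ∧ (𝒢.Stable → 𝒢.AdmitsImplicitRepresentation)) ∧
    (∀ 𝒢 : GraphComm.BipartiteGraphClass, 𝒢.IsUnitDisk ∨ 𝒢.SignRankAtMost 3 →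
      (𝒢.ConstantCost ↔ 𝒢.Stable) ∧ (𝒢.Stable → 𝒢.AdmitsImplicitRepresentation)) := by
  refine ⟨fun 𝒢 h𝒢 => ⟨⟨fun h => h.stable, fun hs => ?_⟩, fun hs => ?_⟩,
    fun 𝒢 h𝒢 => ⟨⟨fun h => h.stable, fun hs => ?_⟩, fun hs => ?_⟩⟩
  · obtain ⟨ι, hι, h⟩ := hs.exists_eqDecides h𝒢
    obtain ⟨c, hc⟩ := GraphComm.exists_computesWithCost_of_eqDecides ι
    exact ⟨c, fun N => iSup₂_le fun G hG => Nat.cast_le.2 (Nat.sInf_le (hc _ (h N G hG)))⟩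
  · obtain ⟨ι, hι, h⟩ := hs.exists_eqDecides h𝒢
    obtain ⟨D, ℓ, hℓ, hD⟩ := GraphComm.exists_labels ι
    refine ⟨D, ℓ, hℓ, fun N G hG => ?_⟩
    simpa using hD _ (h N G hG)
  · obtain ⟨ι, hι, h⟩ := hs.exists_eqDecides h𝒢
    obtain ⟨c, hc⟩ := GraphComm.exists_computesWithCost_of_eqDecides ι
    exact ⟨c, fun N => iSup_le fun m => iSup_le fun n => iSup_le fun _ => iSup₂_le fun B hB =>
      Nat.cast_le.2 (Nat.sInf_le (hc _ (h m n B hB)))⟩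
  · obtain ⟨ι, hι, h⟩ := hs.exists_eqDecides h𝒢
    obtain ⟨D, ℓ, hℓ, hD⟩ := GraphComm.exists_labels (Option (ι ⊕ (ι ⊕ Set ι)))
    refine ⟨D, ℓ, hℓ, fun m n B hB => ?_⟩
    simpa using hD _ (h m n B hB).toSimpleGraph
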